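/- Let $K$ be a field of characteristic $0$, $r\ge 1$, $d=r+1$, and let $M$ be the tridiagonal matrix of order $d$ with diagonal $\alpha_0,\dots,\alpha_r\in K$, where $\alpha_i\ne\alpha_0$ for $i\neq 0$ (in particular, when the $\alpha_i$ are distinct), superdiagonal $b_0,\dots,b_{r-1}$ and subdiagonal $c_0,\dots,c_{r-1}$, the $b_i,c_i$ being formal variables. Put $a_i=\alpha_i-\alpha_0$ for $1\le i\le r$. All expansions are formal power series. \textbf{Notation.} Let $\boldsymbol\xi=(\boldsymbol x,\boldsymbol z)=(x_0,\dots,x_{r-1},z_0,\dots,z_{r-2})$ and $\boldsymbol\eta=(\boldsymbol s,\boldsymbol w)=(s_0,\dots,s_{r-1},w_0,\dots,w_{r-2})$ be formal variables, with $z_{r-1}=w_{r-1}=0$. For integers $i,j$ let $\delta_{ij}$ be the Kronecker symbol, and $\sigma_{ij}=1$ if $i>j$, $\sigma_{ij}=0$ otherwise. For $\boldsymbol\mu\in\mathbb Z^r$ set $$\Phi(\boldsymbol x,\boldsymbol z;\boldsymbol\mu)=\sum_{\boldsymbol m,\boldsymbol p\ge 0}(-\boldsymbol x)^{\boldsymbol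 m}\boldsymbol z^{\boldsymbol p}\prod_{j=0}^{r-1}\binom{\mu_j+m_j+p_{j-1}+p_j-1}{m_j,\;p_j},\qquad \binom{a}{m,p}=\frac{a(a-1)\cdots(a-m-p+1)}{m!\,p!},$$ where $\boldsymbol m\in\mathbb Z_{\ge0}^{r}$, $\boldsymbol p\in\mathbb Z_{\ge0}^{r-1}$, $p_{-1}=m_0+\dots+m_{r-1}$ and $p_{r-1}=0$. Let $$f_0=\dots=f_{r-1}=\frac{1+w_0}{1+s_0},\qquad h_i=\frac{(1+w_i)(1+w_{i+1})}{(1+s_i)(1+s_{i+1})}\quad(0\le i\le r-2),$$ and let $\boldsymbol\varphi=(f_0,\dots,f_{r-1},h_0,\dots,h_{r-2})$. \textbf{Theorem.} (1) The Jacobian $J=\det\bigl(\delta_{jk}-\frac{\eta_k}{\varphi_j}\frac{\partial\varphi_j}{\partial\eta_k}\bigr)$ equals $$S=\Bigl(1+\sum_{j=0}^{r-1}\frac{s_j(1+w_j)}{1+s_j}\prod_{k=0}^{j-1}w_k\Bigr)\prod_{k=0}^{r-2}(1+w_k)^{-1}=\sum_{i=-1}^{r-1}\ \prod_{j=0}^{r-1}\frac{w_j^{\sigma_{ij}}s_j^{\delta_{ij}}}{(1+w_j)^{1-\delta_{ij}}(1+s_j)^{\delta_{ij}}},$$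 a sum of $r+1=d$ terms (with $0^0=1$). (2) There are $2d-3$ variables $(\boldsymbol x,\boldsymbol z)$, and they are independent: the expressions $\frac{b_0c_0}{a_1a_{i+1}}$ ($0\le i\le r-1$) and $\frac{b_{i+1}c_{i+1}}{a_{i+1}a_{i+2}}$ ($0\le i\le r-2$), with all $a_i,b_i,c_i$ indeterminates, are algebraically independent over $K$. (3) For every $\boldsymbol\mu\in\mathbb Z^r$ the series $\Phi(\boldsymbol x,\boldsymbol z;\boldsymbol\mu)$ is a Horn series, i.e. with $A(\boldsymbol q)$ denoting its coefficients, for every direction $v$ there are nonzero polynomials $P_v,Q_v$ in the indices with $Q_v(\boldsymbol q)A(\boldsymbol q+\boldsymbol e_v)=P_v(\boldsymbol q)A(\boldsymbol q)$ for all $\boldsymbol q\ge0$. If all $\mu_j\ge1$, then $$\Phi(\boldsymbol x,\boldsymbol z;\boldsymbol\mu)=\sum_{\boldsymbol m,\boldsymbol p\ge0}\frac{(-\boldsymbol x)^{\boldsymbol m}\boldsymbol z^{\boldsymbol p}}{\boldsymbol m!\,\boldsymbol p!}\prod_{j=0}^{r-1}\frac{(\mu_j)_{m_j+p_j+p_{j-1}}}{(\mu_j)_{p_{j-1}}},\qquad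 (a)_n=a(a+1)\cdots(a+n-1).$$ (4) The system $$u_i=u_{i-1}-x_{i-1}u_1u_i+z_{i-1}u_{i+1}\quad(i=1,\dots,r),\qquad u_0=1,$$ has exactly one solution $u_1,\dots,u_r\in K[[\boldsymbol x,\boldsymbol z]]$; each $u_i$ has constant term $1$. The series $s_i=x_iu_1$, $w_i=z_iu_{i+2}/u_i$ satisfy the Lagrange-type equations $x_if_i(\boldsymbol s,\boldsymbol w)=s_i$, $z_ih_i(\boldsymbol s,\boldsymbol w)=w_i$. For every $\boldsymbol k\in\mathbb Z^r$, $$\boldsymbol u^{\boldsymbol k}=u_1^{k_1}\cdots u_r^{k_r}=\sum_{i=-1}^{r-1}\boldsymbol\xi^{\mathfrak f_i}\,\Phi(\boldsymbol x,\boldsymbol z;\boldsymbol\pi+\boldsymbol\nu^i),\qquad \boldsymbol\xi^{\mathfrak f_i}=\prod_{j=0}^{r-1}x_j^{\delta_{ij}}z_j^{\sigma_{ij}},$$ where $\pi_j=k_{j+1}+\dots+k_r$ and $\nu^i_j=2\sigma_{i,j-1}$ for $0\le j\le r-1$. (5) There is exactly one pair $\Lambda\in K[[\boldsymbol b,\boldsymbol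 c]]$, $V=(V_0,\dots,V_r)\in K[[\boldsymbol b,\boldsymbol c]]^{r+1}$ with $MV=\Lambda V$, $V_0=1$, such that $\Lambda$ has constant term $\alpha_0$ and $V_j$ has constant term $0$ for $j\ne0$. It is given by $$\Lambda=\alpha_0+b_0V_1,\qquad V_i=(-1)^i\frac{c_0\cdots c_{i-1}}{a_1\cdots a_i}\,u_i\quad(1\le i\le r),$$ where $u_i$ is the series of (4) evaluated at $x_j=\frac{b_0c_0}{a_1a_{j+1}}$, $z_j=\frac{b_{j+1}c_{j+1}}{a_{j+1}a_{j+2}}$; in particular the expansion of $\boldsymbol u^{\boldsymbol k}$ in (4) holds at these values for every $\boldsymbol k\in\mathbb Z^r$. -/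

import Mathlib

open scoped BigOperators

noncomputable section

namespace Corner

/-! ### Index conventions -/

/-- Index set of the variables `ξ = (x, z)` (and of `η = (s, w)`):
`Sum.inl i` stands for `x_i` (`s_i`), `0 ≤ i ≤ r - 1`, and
`Sum.inr i` stands for `z_i` (`w_i`), `0 ≤ i ≤ r - 2`. -/
abbrev Var (r : ℕ) := Fin r ⊕ Fin (r - 1)

/-- The first family (`x_j`, `s_j`, or the exponents `m_j`), extended by zero. -/
def fstExt {R : Type*} [Zero R] {r : ℕ} (ξ : Var r → R) (j : ℕ) : R :=
  if h : j < r then ξ (Sum.inl ⟨j, h⟩) else 0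

/-- The second family (`z_j`, `w_j`, or the exponents `p_j`), extended by zero;
this contains the conventions `z_{r-1} = w_{r-1} = 0` and `p_{r-1} = 0`. -/
def sndExt {R : Type*} [Zero R] {r : ℕ} (ξ : Var r → R) (j : ℕ) : R :=
  if h : j < r - 1 then ξ (Sum.inr ⟨j, h⟩) else 0

/-- The exponent `p_{j-1}`, where `p_{-1} = |m| = m_0 + … + m_{r-1}`. -/
def pPrev {r : ℕ} (q : Var r → ℕ) : ℕ → ℕ
  | 0 => ∑ i : Fin r, q (Sum.inl i)
  | j + 1 => sndExt q j

/-- The sequence `u_0 = 1, u_1, …, u_r`, where `u_{i+1}` is stored as `u i`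
(the value past `r` is irrelevant). -/
def uExt {R : Type*} [One R] {r : ℕ} (u : Fin r → R) : ℕ → R
  | 0 => 1
  | j + 1 => if h : j < r then u ⟨j, h⟩ else 1

/-- The step function: `σ_{ij} = 1` if `i > j`, and `0` otherwise. -/
def step (i j : ℤ) : ℕ := if j < i then 1 else 0

/-- The Kronecker symbol `δ_{ij}`. -/
def delta (i j : ℤ) : ℕ := if i = j then 1 else 0

/-! ### The eigenvalue problem -/

/-- Tridiagonal matrix of order `r + 1` with diagonal `α_0, …, α_r`, superdiagonal
`b_0, …, b_{r-1}` and subdiagonal `c_0, …, c_{r-1}`. -/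
def jacobiMatrix {R : Type*} [Zero R] {r : ℕ} (α : Fin (r + 1) → R) (b c : Fin r → R) :
    Matrix (Fin (r + 1)) (Fin (r + 1)) R :=
  Matrix.of fun i j =>
    if i = j then α i
    else if h : (i : ℕ) + 1 = j then b ⟨i, by omega⟩
    else if h : (j : ℕ) + 1 = i then c ⟨j, by omega⟩
    else 0

/-- Formal power series in the off-diagonal elements `b_0, …, b_{r-1}` (index `Sum.inl`)
and `c_0, …, c_{r-1}` (index `Sum.inr`). -/
abbrev OffDiagSeries (K : Type*) (r : ℕ) := MvPowerSeries (Fin r ⊕ Fin r) K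

/-- The off-diagonal elements `b_i` as formal variables. -/
def bVar (K : Type*) [Field K] (r : ℕ) (i : Fin r) : OffDiagSeries K r :=
  MvPowerSeries.X (Sum.inl i)

/-- The off-diagonal elements `c_i` as formal variables. -/
def cVar (K : Type*) [Field K] (r : ℕ) (i : Fin r) : OffDiagSeries K r :=
  MvPowerSeries.X (Sum.inr i)

/-- `(Λ, V)` is the branch growing from the corner entry `α_0`: `M V = Λ V`, normalised by
`V_0 = 1`, with `Λ = α_0 + higher order terms` and `V_j = 0 + higher order terms`, `j ≠ 0`. -/
structure IsCornerBranch {K : Type*} [Field K] {r : ℕ} (α : Fin (r + 1) → K)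
    (lam : OffDiagSeries K r) (V : Fin (r + 1) → OffDiagSeries K r) : Prop where
  eigen : (jacobiMatrix (fun i => MvPowerSeries.C (α i)) (bVar K r) (cVar K r)).mulVec V
    = lam • V
  normalized : V 0 = 1
  constantCoeff_eigenvalue : MvPowerSeries.constantCoeff lam = α 0
  constantCoeff_vector : ∀ j, j ≠ 0 → MvPowerSeries.constantCoeff (V j) = 0

/-- The expansion variables in terms of the matrix elements (`a i` stands for `a_{i+1}`):
`x_i = b_0 c_0 / (a_1 a_{i+1})` and `z_i = b_{i+1} c_{i+1} / (a_{i+1} a_{i+2})`. -/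
def xi {K R : Type*} [Field K] [CommRing R] [Algebra K R] {r : ℕ}
    (a : Fin r → K) (b c : Fin r → R) : Var r → R
  | Sum.inl i => (a ⟨0, i.pos⟩ * a i)⁻¹ • (b ⟨0, i.pos⟩ * c ⟨0, i.pos⟩)
  | Sum.inr i => (a ⟨i, by omega⟩ * a ⟨i + 1, by omega⟩)⁻¹ •
      (b ⟨i + 1, by omega⟩ * c ⟨i + 1, by omega⟩)

/-- The scaling factor of the eigenvector component `v_{j+1}`:
`v_{j+1}^0 = (-1)^{j+1} (c_0 ⋯ c_j) / (a_1 ⋯ a_{j+1})`. -/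
def vZero {K R : Type*} [Field K] [CommRing R] [Algebra K R] {r : ℕ}
    (a : Fin r → K) (c : Fin r → R) (j : Fin r) : R :=
  ((-1) ^ ((j : ℕ) + 1) * (∏ i ∈ Finset.Iic j, a i)⁻¹) • ∏ i ∈ Finset.Iic j, c i

/-- The quadratic system
`u_i = u_{i-1} - x_{i-1} u_1 u_i + z_{i-1} u_{i+1}`, `i = 1, …, r`, with `u_0 = 1`. -/
def IsCornerSolution {R : Type*} [CommRing R] {r : ℕ} (ξ : Var r → R) (u : Fin r → R) : Prop :=
  ∀ i : Fin r, uExt u (i + 1) =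
    uExt u i - ξ (Sum.inl i) * uExt u 1 * uExt u (i + 1) + sndExt ξ i * uExt u (i + 2)

/-! ### The Lagrange-type system and its Jacobian -/

/-- Formal power series in the variables `ξ = (x, z)`, or in `η = (s, w)`. -/
abbrev Series (K : Type*) (r : ℕ) := MvPowerSeries (Var r) K

/-- The variables `s_j`, extended by zero. -/
def sVar (K : Type*) [Field K] (r j : ℕ) : Series K r :=
  fstExt (fun v : Var r => (MvPowerSeries.X v : Series K r)) j

/-- The variables `w_j`, with `w_{r-1} = 0`. -/
def wVar (K : Type*) [Field K] (r j : ℕ) : Series K r :=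
  sndExt (fun v : Var r => (MvPowerSeries.X v : Series K r)) j

/-- The functions `φ = (f, h)` of `η = (s, w)`: `f_i = (1 + w_0) / (1 + s_0)` and
`h_i = (1 + w_i) (1 + w_{i+1}) / ((1 + s_i) (1 + s_{i+1}))`. -/
def phi (K : Type*) [Field K] (r : ℕ) : Var r → Series K r
  | Sum.inl _ => (1 + wVar K r 0) * (1 + sVar K r 0)⁻¹
  | Sum.inr i => (1 + wVar K r i) * (1 + wVar K r (i + 1)) *
      ((1 + sVar K r i) * (1 + sVar K r (i + 1)))⁻¹

/-- The Jacobian of the Lagrange inversion formula for the system `ξ_j = η_j / φ_j(η)`: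
`J = det (δ_{jk} - (η_k / φ_j) ∂φ_j/∂η_k)`. -/
def lagrangeJacobian {K σ : Type*} [Field K] [Fintype σ] [DecidableEq σ]
    (φ : σ → MvPowerSeries σ K) : MvPowerSeries σ K :=
  Matrix.det (Matrix.of fun j k =>
    (if j = k then 1 else 0) -
      MvPowerSeries.X k * (φ j)⁻¹ * MvPowerSeries.pderiv K k (φ j))

/-- `S = (1 + ∑_{j<r} s_j (1 + w_j) / (1 + s_j) ∏_{k<j} w_k) ∏_{k ≤ r-2} (1 + w_k)⁻¹`. -/
def S (K : Type*) [Field K] (r : ℕ) : Series K r :=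
  (1 + ∑ j ∈ Finset.range r, sVar K r j * (1 + wVar K r j) * (1 + sVar K r j)⁻¹ *
      ∏ k ∈ Finset.range j, wVar K r k) *
    ∏ k ∈ Finset.range (r - 1), (1 + wVar K r k)⁻¹

/-- The `i`-th of the `r + 1` terms of `S`, `i = -1, …, r - 1`:
`∏_j w_j^{σ_ij} s_j^{δ_ij} / ((1 + w_j)^{1 - δ_ij} (1 + s_j)^{δ_ij})`. -/
def STerm (K : Type*) [Field K] (r : ℕ) (i : ℤ) : Series K r :=
  ∏ j ∈ Finset.range r, wVar K r j ^ step i j * sVar K r j ^ delta i j *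
    ((1 + wVar K r j) ^ (1 - delta i j) * (1 + sVar K r j) ^ delta i j)⁻¹

/-- The Lagrange variables attached to `u`: `s_i = x_i u_1` and `w_i = z_i u_{i+2} / u_i`. -/
def etaOf {R : Type*} [CommRing R] {r : ℕ} (ξ : Var r → R) (u : Fin r → Rˣ) : Var r → R
  | Sum.inl i => ξ (Sum.inl i) * (uExt u 1 : Rˣ)
  | Sum.inr i => ξ (Sum.inr i) * ((uExt u (i + 2) * (uExt u i)⁻¹ : Rˣ) : R)

/-! ### The hypergeometric series -/

/-- The trinomial coefficient `binom(a; m, p) = a (a-1) ⋯ (a-m-p+1) / (m! p!)`. -/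
def trinom (K : Type*) [Field K] (a : ℤ) (m p : ℕ) : K :=
  (∏ t ∈ Finset.range (m + p), ((a : K) - t)) / (m.factorial * p.factorial)

/-- The series `Φ(x, z; μ) = ∑_{m,p ≥ 0} (-x)^m z^p
∏_{j<r} binom(μ_j + m_j + p_{j-1} + p_j - 1; m_j, p_j)`. -/
def Phi (K : Type*) [Field K] (r : ℕ) (μ : Fin r → ℤ) : Series K r :=
  fun q => (-1) ^ (∑ i : Fin r, q (Sum.inl i)) *
    ∏ j : Fin r, trinom K (μ j + q (Sum.inl j) + pPrev q j + sndExt q j - 1)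
      (q (Sum.inl j)) (sndExt q j)

/-- The Pochhammer symbol `(a)_n = a (a+1) ⋯ (a+n-1)`. -/
def poch (K : Type*) [Field K] (a : ℤ) (n : ℕ) : K := ∏ t ∈ Finset.range n, ((a : K) + t)

/-- The series `∑_{m,p ≥ 0} (-x)^m z^p / (m! p!)
∏_{j<r} (μ_j)_{m_j + p_j + p_{j-1}} / (μ_j)_{p_{j-1}}`. -/
def PhiPoch (K : Type*) [Field K] (r : ℕ) (μ : Fin r → ℤ) : Series K r :=
  fun q => (-1) ^ (∑ i : Fin r, q (Sum.inl i)) / (∏ v : Var r, ((q v).factorial : K)) *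
    ∏ j : Fin r, poch K (μ j) (q (Sum.inl j) + sndExt q j + pPrev q j) /
      poch K (μ j) (pPrev q j)

/-- Horn series: for every variable, the ratio of adjacent coefficients is a rational function
`P / Q` of the indices (written without denominators, since coefficients may vanish). -/
def IsHornSeries {K σ : Type*} [Field K] (f : MvPowerSeries σ K) : Prop :=
  ∀ v : σ, ∃ P Q : MvPolynomial σ K, P ≠ 0 ∧ Q ≠ 0 ∧ ∀ n : σ →₀ ℕ,
    MvPolynomial.eval (fun w => (n w : K)) Q * MvPowerSeries.coeff (n + Finsupp.single v 1) f =
      MvPolynomial.eval (fun w => (n w : K)) P * MvPowerSeries.coeff n f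

/-- `ξ^{f_i} = ∏_{j<r} x_j^{δ_ij} z_j^{σ_ij}`: `1` for `i = -1`, `x_i z_0 ⋯ z_{i-1}` for `i ≥ 0`. -/
def monoF {R : Type*} [CommRing R] {r : ℕ} (ξ : Var r → R) (i : ℤ) : R :=
  ∏ j : Fin r, ξ (Sum.inl j) ^ delta i j * sndExt ξ j ^ step i j

/-- `π_j = k_{j+1} + … + k_r`, where `k_{i+1}` is stored as `k i`. -/
def piVec {r : ℕ} (k : Fin r → ℤ) (j : Fin r) : ℤ := ∑ i ∈ Finset.Ici j, k i

/-- `ν^i_j = 2 σ_{i,j-1}`. -/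
def nuVec {r : ℕ} (i : ℤ) (j : Fin r) : ℤ := 2 * step i ((j : ℤ) - 1)

end Corner

end

namespace Corner

variable {K : Type*} [Field K]

/-! ### The factors of the coefficients of `Φ` -/

/-! The key is to linearise the quadratic system. Index a monomial `u^k` by `μ = π(k)`, so that the
unit vector `e_j` stands for `u_{j+1}/u_j` and `u_i` for the indicator of `{j < i}`. Multiplying the
quadratic equations by arbitrary monomials shows that `G(μ) = u^k` satisfies `G(ν+e_j) = G(ν) - x_j
G(ν+e_j+e_0) + z_j G(ν+e_j+e_{j+1})`.

Coefficient by coefficient, `Φ` satisfies these recurrences by Pascal's rule (`isCornerFamily_Phi`).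
They are linear and translation invariant, so `F(μ) = ∑_i ξ^{f_i} Φ(μ+ν^i)` satisfies them as well.
A telescoping identity gives `F(0) = 1` (`cornerSum_zero`). A solution of the recurrences is
determined by its value at `0`, since going from `ν` to `ν+e_j` changes it only by terms with a
factor `x_j` or `z_j` (`IsCornerFamily.eq_zero`). Hence `F(μ+ν) = F(μ)F(ν)` (`cornerSum_add`): `F`
is a homomorphism into the units. Its values at the indicators solve the quadratic system, and its
value at `π(k)` is `u^k`. Lagrange inversion is not used.

The other claims rest on separate observations. The quadratic system says that `(1+w_j)/(1+s_j)`
takes the value `u_{j+1}/u_j`, which gives the Lagrange-type equations. The Jacobian is `det(1 -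
EL)`, with `L` the logarithmic derivatives of these `r` ratios and `E` their exponents in `φ`; it
equals the `r × r` determinant `det(1 - LE)`, which is bidiagonal except in its first column.
Algebraic independence follows from a specialisation of `a, b, c` that gives the variables
prescribed values. Rescaling the eigenvector turns the rows of `MV = ΛV` below the top one into the
quadratic system, while the top row gives `Λ`. -/

theorem poch_zero (a : ℤ) : poch K a 0 = 1 := by simp [poch]

theorem poch_succ (a : ℤ) (n : ℕ) : poch K a (n + 1) = poch K a n * (a + n) :=
  Finset.prod_range_succ _ _

theorem poch_succ_left (a : ℤ) (n : ℕ) : poch K a (n + 1) = a * poch K (a + 1) n := by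
  rw [poch, Finset.prod_range_succ', mul_comm, poch]
  congr 1
  · simp
  · refine Finset.prod_congr rfl fun t _ => ?_
    push_cast
    ring

theorem poch_add (a : ℤ) (m n : ℕ) : poch K a (m + n) = poch K a m * poch K (a + m) n := by
  rw [poch, Finset.prod_range_add, poch, poch]
  congr 1
  refine Finset.prod_congr rfl fun t _ => ?_
  push_cast
  ring

/-- `(a)_{m+p} / (m! p!)`. -/
def pochFactor (K : Type*) [Field K] (a : ℤ) (m p : ℕ) : K :=
  poch K a (m + p) / (m.factorial * p.factorial)

theorem trinom_eq_pochFactor (a : ℤ) (m p : ℕ) :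
    trinom K (a + m + p - 1) m p = pochFactor K a m p := by
  rw [trinom, pochFactor, poch]
  congr 1
  rw [← Finset.prod_range_reflect]
  refine Finset.prod_congr rfl fun t ht => ?_
  have ht' : t + 1 ≤ m + p := Finset.mem_range.1 ht
  have h : ((m + p - 1 - t : ℕ) : K) = (m : K) + p - 1 - t := by
    rw [Nat.sub_sub, Nat.cast_sub (by omega)]
    push_cast
    ring
  rw [h]
  push_cast
  ring

/-- The factor `(a)_{m-k+p-l} / ((m-k)! (p-l)!)`, understood as `0` for `m < k` or `p < l`. -/
def pochFactorSub (K : Type*) [Field K] (a : ℤ) (m p k l : ℕ) : K :=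
  if k ≤ m ∧ l ≤ p then pochFactor K a (m - k) (p - l) else 0

@[simp]
theorem pochFactorSub_zero (a : ℤ) (m p : ℕ) :
    pochFactorSub K a m p 0 0 = pochFactor K a m p := by
  simp [pochFactorSub]

variable [CharZero K]

/-- The factor `a` completes `(a+1)_{m-1+p}` to `(a)_{m+p}`, and `m` turns `1/m!` into `1/(m-1)!`.
Keeping `a` as a multiplier avoids dividing by it when it vanishes. -/
theorem mul_pochFactorSub_fst (a : ℤ) (m p : ℕ) :
    (a : K) * pochFactorSub K (a + 1) m p 1 0 = m * pochFactor K a m p := by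
  cases m with
  | zero => simp [pochFactorSub]
  | succ m =>
    have h1 : (m.factorial : K) ≠ 0 := Nat.cast_ne_zero.2 m.factorial_ne_zero
    have h2 : (p.factorial : K) ≠ 0 := Nat.cast_ne_zero.2 p.factorial_ne_zero
    have h3 : (m : K) + 1 ≠ 0 := Nat.cast_add_one_ne_zero m
    simp only [pochFactorSub, pochFactor, Nat.le_add_left, zero_le, and_self, if_true,
      Nat.add_sub_cancel, Nat.sub_zero, Nat.factorial_succ, Nat.cast_mul, Nat.cast_add, Nat.cast_one,
      show m + 1 + p = m + p + 1 by ring, poch_succ_left]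
    field_simp

theorem mul_pochFactorSub_snd (a : ℤ) (m p : ℕ) :
    (a : K) * pochFactorSub K (a + 1) m p 0 1 = p * pochFactor K a m p := by
  cases p with
  | zero => simp [pochFactorSub]
  | succ p =>
    have h1 : (m.factorial : K) ≠ 0 := Nat.cast_ne_zero.2 m.factorial_ne_zero
    have h2 : (p.factorial : K) ≠ 0 := Nat.cast_ne_zero.2 p.factorial_ne_zero
    have h3 : (p : K) + 1 ≠ 0 := Nat.cast_add_one_ne_zero p
    simp only [pochFactorSub, pochFactor, Nat.le_add_left, zero_le, and_self, if_true,
      Nat.add_sub_cancel, Nat.sub_zero, Nat.factorial_succ, Nat.cast_mul, Nat.cast_add, Nat.cast_one,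
      show m + (p + 1) = m + p + 1 by ring, poch_succ_left]
    field_simp

/-- Pascal's rule for the factors of the coefficients of `Φ`. -/
theorem pochFactor_add_one (a : ℤ) (m p : ℕ) :
    pochFactor K (a + 1) m p = pochFactor K a m p + pochFactorSub K (a + 1) m p 1 0 +
      pochFactorSub K (a + 1) m p 0 1 := by
  have h1 : (m.factorial : K) ≠ 0 := Nat.cast_ne_zero.2 m.factorial_ne_zero
  have h2 : (p.factorial : K) ≠ 0 := Nat.cast_ne_zero.2 p.factorial_ne_zero
  -- With `n + 1 = m + p`, the correction term splits as `m + p`; its two parts lower `m` and `p` by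
  -- one respectively.
  have key : ∀ n : ℕ, poch K (a + 1) (n + 1) = poch K a (n + 1) + (n + 1) * poch K (a + 1) n := by
    intro n
    rw [poch_succ_left a, poch_succ (a + 1)]
    push_cast
    ring
  rcases m with _ | m <;> rcases p with _ | p
  · simp [pochFactorSub, pochFactor, poch_zero]
  · have h3 : (p.factorial : K) ≠ 0 := Nat.cast_ne_zero.2 p.factorial_ne_zero
    have h4 : (p : K) + 1 ≠ 0 := Nat.cast_add_one_ne_zero p
    simp only [pochFactorSub, pochFactor, zero_add, key p]
    simp [Nat.factorial_succ]
    field_simp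
  · have h3 : (m.factorial : K) ≠ 0 := Nat.cast_ne_zero.2 m.factorial_ne_zero
    have h4 : (m : K) + 1 ≠ 0 := Nat.cast_add_one_ne_zero m
    simp only [pochFactorSub, pochFactor, add_zero, key m]
    simp [Nat.factorial_succ]
    field_simp
  · have h3 : (m.factorial : K) ≠ 0 := Nat.cast_ne_zero.2 m.factorial_ne_zero
    have h4 : (m : K) + 1 ≠ 0 := Nat.cast_add_one_ne_zero m
    have h5 : (p.factorial : K) ≠ 0 := Nat.cast_ne_zero.2 p.factorial_ne_zero
    have h6 : (p : K) + 1 ≠ 0 := Nat.cast_add_one_ne_zero p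
    have e1 : m + 1 + (p + 1) = m + p + 1 + 1 := by ring
    have e2 : m + (p + 1) = m + p + 1 := by ring
    have e3 : m + 1 + p = m + p + 1 := by ring
    simp only [pochFactorSub, pochFactor, Nat.le_add_left, zero_le, and_self, if_true,
      Nat.add_sub_cancel, Nat.sub_zero, Nat.factorial_succ, Nat.cast_mul, Nat.cast_add,
      Nat.cast_one, e1, e2, e3, key (m + p + 1)]
    field_simp
    ring

/-- The telescoping identity behind `∑ ξ^{f_i} Φ(ν^i) = 1`. -/
theorem mul_sum_prod_pochFactorSub (n : ℕ) (X : ℕ → ℤ) (m p : ℕ → ℕ) (hX : ∀ l, X (l + 1) = p l) :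
    (X 0 : K) * ∑ i ∈ Finset.range n, ∏ l ∈ Finset.range n,
        pochFactorSub K (X l + if l ≤ i then 1 else 0) (m l) (p l)
          (if l = i then 1 else 0) (if l < i then 1 else 0) =
      (∑ i ∈ Finset.range n, (m i : K)) *
        ∏ l ∈ Finset.range n, pochFactor K (X l) (m l) (p l) := by
  induction n generalizing X m p with
  | zero => simp
  | succ n ih =>
    have h := ih (fun l => X (l + 1)) (fun l => m (l + 1)) (fun l => p (l + 1)) fun l => hX (l + 1)
    simp only [zero_add, hX 0, Int.cast_natCast] at h
    rw [Finset.sum_range_succ', Finset.sum_range_succ' (fun i => (m i : K))]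
    simp only [Finset.prod_range_succ' _ n, add_le_add_iff_right, add_left_inj,
      add_lt_add_iff_right, zero_le, if_true, Nat.zero_lt_succ, ← Finset.sum_mul,
      nonpos_iff_eq_zero, if_false, add_zero, Nat.succ_ne_zero, not_lt_zero,
      (Nat.succ_ne_zero _).symm, pochFactorSub_zero]
    -- In the factor `l = 0`, the term `i = 0` produces `m 0`, and all terms `i > 0` produce the
    -- common multiplier `p 0`. As `p 0 = X 1`, this is the multiplier needed by the induction
    -- hypothesis for the shifted sequences.
    have h1 := mul_pochFactorSub_fst (K := K) (X 0) (m 0) (p 0)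
    have h2 := mul_pochFactorSub_snd (K := K) (X 0) (m 0) (p 0)
    linear_combination (∏ l ∈ Finset.range n, pochFactor K (X (l + 1)) (m (l + 1)) (p (l + 1))) * h1
      + (∑ i ∈ Finset.range n, ∏ l ∈ Finset.range n,
        pochFactorSub K (X (l + 1) + if l ≤ i then 1 else 0) (m (l + 1)) (p (l + 1))
          (if l = i then 1 else 0) (if l < i then 1 else 0)) * h2
      + pochFactor K (X 0) (m 0) (p 0) * h

omit [CharZero K] in
-- Pure `z`-monomials do not occur in `Φ(·; 0)`. Going down from an index with `p k ≠ 0`, either `X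
-- k = 0` and the factor contains `(0)_{p k} = 0`, or `p (k-1) = X k ≠ 0` and the descent continues;
-- it stops at the latest at `X 0 = 0`.
theorem prod_pochFactor_eq_zero (n : ℕ) (X : ℕ → ℤ) (m p : ℕ → ℕ) (hX : ∀ l, X (l + 1) = p l)
    (h0 : X 0 = 0) (hm : ∀ l, m l = 0) {k : ℕ} (hk : k < n) (hp : p k ≠ 0) :
    ∏ l ∈ Finset.range n, pochFactor K (X l) (m l) (p l) = 0 := by
  induction k using Nat.strong_induction_on with
  | _ k ih =>
    by_cases hX' : X k = 0
    · refine Finset.prod_eq_zero (Finset.mem_range.2 hk) ?_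
      obtain ⟨s, hs⟩ := Nat.exists_eq_succ_of_ne_zero hp
      simp [pochFactor, hm, hX', hs, poch_succ_left]
    · rcases k with _ | k
      · exact absurd h0 hX'
      · refine ih k (Nat.lt_succ_self k) (by omega) ?_
        rw [hX] at hX'
        exact_mod_cast hX'

end Corner

namespace Corner

variable {K : Type*} [Field K]

/-! ### Coefficients of monomial multiples of `Φ` -/

/-! ### Exponent vectors of single variables and of `ξ^{f_i}`. -/

section Exponents

variable {r : ℕ}

theorem fstExt_apply {R : Type*} [Zero R] (ξ : Var r → R) (j : Fin r) :
    fstExt ξ j = ξ (Sum.inl j) := dif_pos j.2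

theorem sndExt_apply {R : Type*} [Zero R] (ξ : Var r → R) (j : Fin (r - 1)) :
    sndExt ξ j = ξ (Sum.inr j) := dif_pos j.2

theorem sndExt_of_le {R : Type*} [Zero R] (ξ : Var r → R) {j : ℕ} (h : r - 1 ≤ j) :
    sndExt ξ j = 0 := dif_neg h.not_gt

theorem sndExt_add (q e : Var r →₀ ℕ) (j : ℕ) : sndExt (q + e) j = sndExt q j + sndExt e j := by
  by_cases h : j < r - 1 <;> simp [sndExt, h]

theorem pPrev_add (q e : Var r →₀ ℕ) (j : ℕ) : pPrev (q + e) j = pPrev q j + pPrev e j := by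
  cases j with
  | zero => simp [pPrev, Finset.sum_add_distrib]
  | succ j => exact sndExt_add q e j

@[simp]
theorem single_inl_apply_inl (i j : Fin r) :
    (Finsupp.single (Sum.inl i) 1 : Var r →₀ ℕ) (Sum.inl j) = if (j : ℕ) = i then 1 else 0 := by
  rw [Finsupp.single_apply]
  simp [Fin.ext_iff, eq_comm]

@[simp]
theorem sndExt_single_inl (i : Fin r) (j : ℕ) :
    sndExt (Finsupp.single (Sum.inl i) 1 : Var r →₀ ℕ) j = 0 := by
  simp [sndExt]

@[simp]
theorem pPrev_single_inl (i : Fin r) (j : ℕ) :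
    pPrev (Finsupp.single (Sum.inl i) 1 : Var r →₀ ℕ) j = if j = 0 then 1 else 0 := by
  cases j with
  | zero => simp [pPrev, ← Fin.ext_iff]
  | succ j => simp [pPrev]

@[simp]
theorem sndExt_single_inr (i : Fin (r - 1)) (j : ℕ) :
    sndExt (Finsupp.single (Sum.inr i) 1 : Var r →₀ ℕ) j = if j = i then 1 else 0 := by
  have := i.2
  by_cases h : j < r - 1
  · simp only [sndExt, h, dif_pos, Finsupp.single_apply]
    simp [Fin.ext_iff, eq_comm]
  · rw [sndExt_of_le _ (not_lt.1 h), if_neg (by omega)]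

@[simp]
theorem pPrev_single_inr (i : Fin (r - 1)) (j : ℕ) :
    pPrev (Finsupp.single (Sum.inr i) 1 : Var r →₀ ℕ) j = if j = i + 1 then 1 else 0 := by
  cases j with
  | zero => simp [pPrev]
  | succ j => simp [pPrev]

/-- The exponent of `ξ^{f_i}`. -/
noncomputable def expF (r i : ℕ) : Var r →₀ ℕ :=
  Finsupp.equivFunOnFinite.symm
    (Sum.elim (fun l => if (l : ℕ) = i then 1 else 0) fun l => if (l : ℕ) < i then 1 else 0)

@[simp]
theorem expF_inl (i : ℕ) (l : Fin r) : expF r i (Sum.inl l) = if (l : ℕ) = i then 1 else 0 := rfl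

@[simp]
theorem expF_inr (i : ℕ) (l : Fin (r - 1)) :
    expF r i (Sum.inr l) = if (l : ℕ) < i then 1 else 0 := rfl

theorem sndExt_expF {i : ℕ} (hi : i < r) (l : ℕ) :
    sndExt (expF r i) l = if l < i then 1 else 0 := by
  by_cases h : l < r - 1
  · simp [sndExt, h]
  · rw [sndExt_of_le _ (not_lt.1 h), if_neg (by omega)]

theorem sum_expF_inl {i : ℕ} (hi : i < r) : ∑ l : Fin r, expF r i (Sum.inl l) = 1 := by
  rw [Finset.sum_eq_single ⟨i, hi⟩] <;> simp [Fin.ext_iff]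

theorem pPrev_expF {i : ℕ} (hi : i < r) (l : ℕ) :
    pPrev (expF r i) l = if l ≤ i then 1 else 0 := by
  cases l with
  | zero => exact (sum_expF_inl hi).trans (by simp)
  | succ l => exact (sndExt_expF hi l).trans (by simp)

theorem monoF_neg_one {R : Type*} [CommRing R] (ξ : Var r → R) : monoF ξ (-1) = 1 := by
  refine Finset.prod_eq_one fun j _ => ?_
  have h1 : delta (-1) j = 0 := if_neg (by omega)
  have h2 : step (-1) j = 0 := if_neg (by omega)
  rw [h1, h2, pow_zero, pow_zero, mul_one]

theorem monoF_natCast {i : ℕ} (hi : i < r) :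
    monoF (MvPowerSeries.X : Var r → Series K r) i = MvPowerSeries.monomial (expF r i) 1 := by
  rw [MvPowerSeries.monomial_one_eq, Finsupp.prod_fintype _ _ fun _ => pow_zero _,
    Fintype.prod_sum_type, monoF, Finset.prod_mul_distrib]
  congr 1
  · refine Finset.prod_congr rfl fun j _ => ?_
    rw [expF_inl, delta]
    congr 1
    simp [eq_comm]
  · obtain ⟨n, rfl⟩ : ∃ n, r = n + 1 := ⟨r - 1, by omega⟩
    rw [Fin.prod_univ_castSucc]
    have h : step i ((Fin.last n : Fin (n + 1)) : ℕ) = 0 := if_neg (by simp; omega)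
    rw [h, pow_zero, mul_one]
    refine Finset.prod_congr rfl fun j _ => ?_
    rw [expF_inr, step, Fin.val_castSucc]
    congr 1
    · exact sndExt_apply (r := n + 1) _ j
    · simp

end Exponents

/-! ### Pascal's rule as a recurrence for `Φ`. -/

section Coefficients

variable {r : ℕ}

theorem coeff_Phi (μ : Fin r → ℤ) (q : Var r →₀ ℕ) :
    MvPowerSeries.coeff q (Phi K r μ) = (-1) ^ (∑ i : Fin r, q (Sum.inl i)) *
      ∏ j : Fin r, pochFactor K (μ j + pPrev q j) (q (Sum.inl j)) (sndExt q j) := by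
  change Phi K r μ q = _
  rw [Phi]
  congr 1
  refine Finset.prod_congr rfl fun j _ => ?_
  rw [← trinom_eq_pochFactor]
  congr 1
  ring

/-- Multiplication by a monomial shifts all factors at once. The zero convention in `pochFactorSub`
covers the case `e ≰ q`, so one product formula serves every `q`, and coefficients of different
multiples of `Φ` can be compared factor by factor. -/
theorem coeff_monomial_mul_Phi (e : Var r →₀ ℕ) (μ : Fin r → ℤ) (q : Var r →₀ ℕ) :
    MvPowerSeries.coeff q (MvPowerSeries.monomial e 1 * Phi K r μ) =
      (-1) ^ (∑ i : Fin r, q (Sum.inl i)) * ((-1) ^ (∑ i : Fin r, e (Sum.inl i)) *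
        ∏ j : Fin r, pochFactorSub K (μ j + pPrev q j - pPrev e j) (q (Sum.inl j)) (sndExt q j)
          (e (Sum.inl j)) (sndExt e j)) := by
  rw [MvPowerSeries.coeff_monomial_mul]
  split_ifs with h
  · obtain ⟨q, rfl⟩ := exists_add_of_le h
    rw [add_tsub_cancel_left, one_mul, coeff_Phi, ← mul_assoc]
    congr 1
    · simp only [Finsupp.add_apply, Finset.sum_add_distrib, pow_add]
      rw [mul_comm, ← mul_assoc, ← mul_pow]
      simp
    · refine Finset.prod_congr rfl fun j _ => ?_
      rw [add_comm e q, sndExt_add, pPrev_add, pochFactorSub, if_pos (by simp), Finsupp.add_apply,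
        Nat.add_sub_cancel, Nat.add_sub_cancel]
      congr 1
      push_cast
      ring
  · symm
    suffices ∃ j : Fin r, ¬ (e (Sum.inl j) ≤ q (Sum.inl j) ∧ sndExt e j ≤ sndExt q j) by
      obtain ⟨j, hj⟩ := this
      rw [Finset.prod_eq_zero (Finset.mem_univ j) (if_neg hj), mul_zero, mul_zero]
    by_contra! h'
    refine h fun v => ?_
    rcases v with j | j
    · exact (h' j).1
    · have := (h' ⟨j, by omega⟩).2
      rwa [sndExt_apply, sndExt_apply] at this

/-- The `n`-th unit vector (zero for `n ≥ r`). -/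
def unitVec (r n : ℕ) : Fin r → ℤ := fun i => if (i : ℕ) = n then 1 else 0

/-- The linear recurrences `G(ν + e_j) = G(ν) - x_j G(ν + e_j + e_0) + z_j G(ν + e_j + e_{j+1})`
satisfied by the powers of the solution of the quadratic system. -/
def IsCornerFamily {R : Type*} [CommRing R] (ξ : Var r → R) (G : (Fin r → ℤ) → R) : Prop :=
  ∀ ν (j : Fin r), G (ν + unitVec r j) = G ν -
    ξ (Sum.inl j) * G (ν + unitVec r j + unitVec r 0) +
    sndExt ξ j * G (ν + unitVec r j + unitVec r (j + 1))

theorem prod_eq_add_of_eq_off {ι R : Type*} [Fintype ι] [DecidableEq ι] [CommRing R]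
    {f g h k : ι → R} (j : ι) (hj : f j = g j + h j + k j) (hg : ∀ i ≠ j, g i = f i)
    (hh : ∀ i ≠ j, h i = f i) (hk : ∀ i ≠ j, k i = f i) :
    ∏ i, f i = ∏ i, g i + ∏ i, h i + ∏ i, k i := by
  have H : ∀ g : ι → R, (∀ i ≠ j, g i = f i) →
      ∏ i, g i = g j * ∏ i ∈ Finset.univ.erase j, f i := fun g hg => by
    rw [← Finset.mul_prod_erase _ _ (Finset.mem_univ j)]
    exact congrArg _ (Finset.prod_congr rfl fun i hi => hg i (Finset.ne_of_mem_erase hi))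
  rw [H f fun _ _ => rfl, H g hg, H h hh, H k hk, hj]
  ring

variable [CharZero K]

/-- The shift of `μ` by `e_0`, respectively `e_{j+1}`, compensates the drop of `p_{-1}`,
respectively `p_j`, caused by the factor `x_j`, respectively `z_j`. Hence all factors except the
`j`-th agree in the four terms, and the `j`-th is Pascal's rule. For `j = r - 1` the `z`-term
vanishes on both sides because `p_{r-1} = 0`. -/
theorem isCornerFamily_Phi : IsCornerFamily MvPowerSeries.X (Phi K r) := by
  intro ν j
  ext q
  have hx := coeff_monomial_mul_Phi (K := K) (Finsupp.single (Sum.inl j) 1)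
    (ν + unitVec r j + unitVec r 0) q
  rw [map_add, map_sub, coeff_Phi, coeff_Phi, show (MvPowerSeries.X (Sum.inl j) : Series K r) =
    MvPowerSeries.monomial (Finsupp.single (Sum.inl j) 1) 1 from rfl, hx]
  have hsum : ∑ i : Fin r, (Finsupp.single (Sum.inl j) 1 : Var r →₀ ℕ) (Sum.inl i) = 1 := by
    simp [← Fin.ext_iff]
  have hz : MvPowerSeries.coeff q (sndExt (MvPowerSeries.X : Var r → Series K r) j *
      Phi K r (ν + unitVec r j + unitVec r (j + 1))) = (-1) ^ (∑ i : Fin r, q (Sum.inl i)) *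
        ∏ i : Fin r, pochFactorSub K (ν i + unitVec r j i + pPrev q i) (q (Sum.inl i)) (sndExt q i)
          0 (if i = j then 1 else 0) := by
    by_cases h : (j : ℕ) < r - 1
    · have := coeff_monomial_mul_Phi (K := K) (Finsupp.single (Sum.inr ⟨j, h⟩) 1)
        (ν + unitVec r j + unitVec r (j + 1)) q
      rw [show sndExt (MvPowerSeries.X : Var r → Series K r) j =
        MvPowerSeries.monomial (Finsupp.single (Sum.inr ⟨j, h⟩) 1) 1 from dif_pos h, this]
      simp only [Finsupp.single_apply, reduceCtorEq, if_false, Finset.sum_const_zero, pow_zero,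
        one_mul, Pi.add_apply, pPrev_single_inr, sndExt_single_inr, ← Fin.ext_iff]
      congr 1
      refine Finset.prod_congr rfl fun i _ => ?_
      congr 1
      simp only [unitVec]
      push_cast
      ring
    · rw [sndExt_of_le _ (not_lt.1 h), zero_mul, map_zero,
        Finset.prod_eq_zero (Finset.mem_univ j), mul_zero]
      rw [if_pos rfl, sndExt_of_le _ (not_lt.1 h)]
      simp [pochFactorSub]
  rw [hz, hsum, pow_one, neg_one_mul, mul_neg, sub_neg_eq_add, ← mul_add, ← mul_add]
  congr 1
  refine prod_eq_add_of_eq_off j ?_ ?_ ?_ ?_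
  · have := pochFactor_add_one (K := K) (ν j + pPrev q j) (q (Sum.inl j)) (sndExt q j)
    simp only [Pi.add_apply, unitVec, if_true, pPrev_single_inl, sndExt_single_inl,
      single_inl_apply_inl, Nat.cast_ite, Nat.cast_one, Nat.cast_zero]
    rw [add_right_comm _ (ite _ _ _), add_sub_cancel_right, add_right_comm _ (1 : ℤ), this]
  all_goals
    intro i hi
    have hi' : (i : ℕ) ≠ j := fun h => hi (Fin.ext h)
    simp [unitVec, hi, hi', add_right_comm _ (ite _ _ _)]

end Coefficients

end Corner

namespace Corner

variable {K : Type*} [Field K]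

/-! ### The series `∑ ξ^{f_i} Φ(μ + ν^i)` -/

theorem sum_Icc_neg_one {M : Type*} [AddCommMonoid M] (r : ℕ) (f : ℤ → M) :
    ∑ i ∈ Finset.Icc (-1 : ℤ) (r - 1), f i = f (-1) + ∑ i ∈ Finset.range r, f i := by
  induction r with
  | zero => simp
  | succ r ih =>
    rw [Finset.sum_range_succ, ← add_assoc, ← ih]
    have : Finset.Icc (-1 : ℤ) ((r + 1 : ℕ) - 1) = insert (r : ℤ) (Finset.Icc (-1 : ℤ) (r - 1)) := by
      ext x
      simp only [Finset.mem_Icc, Finset.mem_insert]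
      push_cast
      omega
    rw [this, Finset.sum_insert (by simp), add_comm]

theorem nuVec_neg_one (r : ℕ) : (nuVec (-1) : Fin r → ℤ) = 0 := by
  ext j
  simp only [nuVec, step, if_neg (show ¬ ((j : ℤ) - 1 < -1) by omega)]
  rfl

theorem nuVec_natCast {r : ℕ} (i : ℕ) (j : Fin r) :
    nuVec (i : ℤ) j = if (j : ℕ) ≤ i then 2 else 0 := by
  have : ((j : ℤ) - 1 < i) ↔ (j : ℕ) ≤ i := by omega
  simp only [nuVec, step, this]
  split_ifs <;> rfl

/-- `∑_i ξ^{f_i} Φ(μ + ν^i)`, which turns out to be `u^k` for `μ = π(k)`. -/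
noncomputable def cornerSum (K : Type*) [Field K] {r : ℕ} (μ : Fin r → ℤ) : Series K r :=
  ∑ i ∈ Finset.Icc (-1 : ℤ) (r - 1), monoF MvPowerSeries.X i * Phi K r (μ + nuVec i)

variable {r : ℕ}

section CornerSum

variable [CharZero K]

theorem isCornerFamily_cornerSum :
    IsCornerFamily MvPowerSeries.X (cornerSum K : (Fin r → ℤ) → Series K r) := by
  intro ν j
  simp only [cornerSum, Finset.mul_sum, ← Finset.sum_sub_distrib, ← Finset.sum_add_distrib]
  refine Finset.sum_congr rfl fun i _ => ?_
  have := isCornerFamily_Phi (K := K) (ν + nuVec i) j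
  rw [add_right_comm ν, this, add_right_comm ν (nuVec i), add_right_comm _ (nuVec i),
    add_right_comm _ (nuVec i)]
  ring

/-- In the coefficient of `x^m z^p` the terms with `i ≥ 0` carry the opposite sign to `Φ(·; 0)`. If
`|m| ≠ 0`, then `X 0 = p_{-1} = |m|` is both multipliers in the telescoping identity, and cancelling
it leaves `0`. If `|m| = 0`, the terms with `i ≥ 0` vanish, each having a factor `x_i`, and `Φ(·;
0)` contributes only its constant term. -/
theorem cornerSum_zero : cornerSum K (0 : Fin r → ℤ) = 1 := by
  classical
  ext q
  rw [cornerSum, sum_Icc_neg_one, monoF_neg_one, nuVec_neg_one, add_zero, one_mul, map_add, map_sum,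
    coeff_Phi, MvPowerSeries.coeff_one]
  set X : ℕ → ℤ := fun l => pPrev q l with hX
  set m : ℕ → ℕ := fun l => fstExt q l with hm
  set p : ℕ → ℕ := fun l => sndExt q l with hp
  have hXp : ∀ l, X (l + 1) = p l := fun l => rfl
  have hml : ∀ l : Fin r, q (Sum.inl l) = m l := fun l => (fstExt_apply _ l).symm
  have hm_sum : ∑ l : Fin r, q (Sum.inl l) = ∑ l ∈ Finset.range r, m l := by
    rw [← Fin.sum_univ_eq_sum_range]
    exact Finset.sum_congr rfl fun l _ => hml l
  have hX0 : X 0 = ((∑ l ∈ Finset.range r, m l : ℕ) : ℤ) := by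
    rw [← hm_sum]
    rfl
  have hi : ∀ i ∈ Finset.range r, MvPowerSeries.coeff q (monoF MvPowerSeries.X (i : ℤ) *
      Phi K r (0 + nuVec (i : ℤ))) = -((-1) ^ (∑ l : Fin r, q (Sum.inl l)) *
        ∏ l ∈ Finset.range r, pochFactorSub K (X l + if l ≤ i then 1 else 0) (m l) (p l)
          (if l = i then 1 else 0) (if l < i then 1 else 0)) := by
    intro i hi
    have hi := Finset.mem_range.1 hi
    rw [monoF_natCast hi, coeff_monomial_mul_Phi, sum_expF_inl hi, pow_one, neg_one_mul, mul_neg,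
      ← Fin.prod_univ_eq_prod_range (fun l => pochFactorSub K (X l + if l ≤ i then 1 else 0) (m l)
        (p l) (if l = i then 1 else 0) (if l < i then 1 else 0))]
    congr 2
    refine Finset.prod_congr rfl fun l _ => ?_
    -- For `l ≤ i` the shift `2` from `ν^i` meets the shift `-1` from `p_{l-1}` in `ξ^{f_i}`,
    -- leaving `+1`.
    rw [expF_inl, pPrev_expF hi, sndExt_expF hi, zero_add, nuVec_natCast, hml]
    congr 1
    split_ifs
    · push_cast
      ring
    · simp [hX]
  rw [Finset.sum_congr rfl hi, Finset.sum_neg_distrib, ← Finset.mul_sum, ← sub_eq_add_neg,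
    ← mul_sub]
  have hA : ∏ l : Fin r, pochFactor K ((0 : Fin r → ℤ) l + pPrev q l) (q (Sum.inl l)) (sndExt q l) =
      ∏ l ∈ Finset.range r, pochFactor K (X l) (m l) (p l) := by
    rw [← Fin.prod_univ_eq_prod_range (fun l => pochFactor K (X l) (m l) (p l))]
    refine Finset.prod_congr rfl fun l _ => ?_
    rw [hml, Pi.zero_apply, zero_add]
  rw [hA]
  have key := mul_sum_prod_pochFactorSub (K := K) r X m p hXp
  by_cases h0 : ∑ l ∈ Finset.range r, m l = 0
  · have hm0 : ∀ l < r, m l = 0 := fun l hl => (Finset.sum_eq_zero_iff.1 h0) l (Finset.mem_range.2 hl)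
    have hm0' : ∀ l, m l = 0 := fun l => by
      by_cases h : l < r
      · exact hm0 l h
      · exact dif_neg h
    rw [Finset.sum_eq_zero (s := Finset.range r), sub_zero, hm_sum, h0, pow_zero, one_mul]
    · split_ifs with hq
      · subst hq
        refine Finset.prod_eq_one fun l _ => ?_
        simp [hm0', hp, sndExt, pochFactor, poch_zero]
      · obtain ⟨v, hv⟩ := Finsupp.ne_iff.1 hq
        rcases v with l | l
        · exact absurd ((hml l).trans (hm0' l)) hv
        · refine prod_pochFactor_eq_zero r X m p hXp (by rw [hX0, h0]; rfl) hm0' (k := l)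
            (by omega) ?_
          simpa [hp, sndExt_apply] using hv
    · intro i hi
      refine Finset.prod_eq_zero hi ?_
      simp [pochFactorSub, hm0']
  · rw [hX0] at key
    have h1 : ((∑ l ∈ Finset.range r, m l : ℕ) : K) ≠ 0 := Nat.cast_ne_zero.2 h0
    rw [← Nat.cast_sum, Int.cast_natCast] at key
    rw [mul_left_cancel₀ h1 key, sub_self, mul_zero, if_neg]
    rintro rfl
    exact h0 (Finset.sum_eq_zero fun l _ => by simp [hm, fstExt])

end CornerSum

/-! ### Uniqueness of formal solutions -/

/-- The ideal of the power series of order at least `n`. -/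
def orderIdeal (σ K : Type*) [Field K] (n : ℕ) : Ideal (MvPowerSeries σ K) where
  carrier := {f | (n : ℕ∞) ≤ f.order}
  zero_mem' := by simp
  add_mem' hf hg := (le_min hf hg).trans MvPowerSeries.min_order_le_add
  smul_mem' a f hf := (le_add_left hf).trans (MvPowerSeries.le_order_mul (f := a) (g := f))

section OrderIdeal

variable {σ : Type*}

theorem mem_orderIdeal {n : ℕ} {f : MvPowerSeries σ K} :
    f ∈ orderIdeal σ K n ↔ (n : ℕ∞) ≤ f.order := Iff.rfl

theorem mul_mem_orderIdeal {n : ℕ} {f g : MvPowerSeries σ K}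
    (hf : MvPowerSeries.constantCoeff f = 0) (hg : g ∈ orderIdeal σ K n) :
    f * g ∈ orderIdeal σ K (n + 1) := by
  have h := MvPowerSeries.one_le_order_iff_constCoeff_eq_zero.2 hf
  rw [mem_orderIdeal] at hg ⊢
  refine le_trans ?_ MvPowerSeries.le_order_mul
  rw [add_comm, Nat.cast_add, Nat.cast_one]
  exact add_le_add h hg

/-- Contraction principle behind all uniqueness proofs below: a family of differences that gains one
order simultaneously in all its members has infinite order. -/
theorem eq_zero_of_forall_mem_orderIdeal {ι : Type*} (d : ι → MvPowerSeries σ K)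
    (h : ∀ n, (∀ i, d i ∈ orderIdeal σ K n) → ∀ i, d i ∈ orderIdeal σ K (n + 1)) (i : ι) :
    d i = 0 := by
  have : ∀ n i, d i ∈ orderIdeal σ K n := by
    intro n
    induction n with
    | zero => intro i; simp [mem_orderIdeal]
    | succ n ih => exact h n ih
  rw [← MvPowerSeries.order_eq_top_iff]
  exact ENat.eq_top_iff_forall_ge.2 fun n => this n i

end OrderIdeal

theorem constantCoeff_sndExt {σ : Type*} (ξ : Var r → MvPowerSeries σ K)
    (hξ : ∀ v, MvPowerSeries.constantCoeff (ξ v) = 0) (j : ℕ) :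
    MvPowerSeries.constantCoeff (sndExt ξ j) = 0 := by
  unfold sndExt
  split_ifs
  · exact hξ _
  · simp

/-- A family satisfying the corner recurrences is determined by its value at `0`. -/
theorem IsCornerFamily.eq_zero {D : (Fin r → ℤ) → Series K r}
    (hD : IsCornerFamily MvPowerSeries.X D) (h0 : D 0 = 0) (μ : Fin r → ℤ) : D μ = 0 := by
  refine eq_zero_of_forall_mem_orderIdeal D (fun n hn μ => ?_) μ
  -- Translations that leave `D` unchanged modulo order `n + 1`. The recurrences put every unit
  -- vector in this group, so it is all of `ℤ^r`, and `D μ` is congruent to `D 0 = 0`.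
  let H : AddSubgroup (Fin r → ℤ) :=
    { carrier := {v | ∀ ν, D (ν + v) - D ν ∈ orderIdeal (Var r) K (n + 1)}
      zero_mem' := fun ν => by simp
      add_mem' := fun {a b} ha hb ν => by
        have := add_mem (hb (ν + a)) (ha ν)
        rwa [sub_add_sub_cancel, add_assoc] at this
      neg_mem' := fun {a} ha ν => by
        have := neg_mem (ha (ν + -a))
        rwa [neg_add_cancel_right, neg_sub] at this }
  have hgen : ∀ j : Fin r, (Pi.single j 1 : Fin r → ℤ) ∈ H := by
    intro j ν
    have hj : (Pi.single j 1 : Fin r → ℤ) = unitVec r j := by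
      ext i
      simp [unitVec, Pi.single_apply, Fin.ext_iff]
    rw [hj, hD ν j, sub_add, sub_sub_cancel_left, neg_sub]
    exact sub_mem
      (mul_mem_orderIdeal (constantCoeff_sndExt _ (fun v => MvPowerSeries.constantCoeff_X v) _) (hn _))
      (mul_mem_orderIdeal (MvPowerSeries.constantCoeff_X _) (hn _))
  have hμ : μ ∈ H := by
    have : μ = ∑ j, μ j • (Pi.single j 1 : Fin r → ℤ) := by
      ext i
      simp [Finset.sum_apply, Pi.single_apply]
    rw [this]
    exact sum_mem fun j _ => zsmul_mem (hgen j) _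
  simpa [h0] using hμ 0

theorem IsCornerFamily.ext {F G : (Fin r → ℤ) → Series K r}
    (hF : IsCornerFamily MvPowerSeries.X F) (hG : IsCornerFamily MvPowerSeries.X G)
    (h0 : F 0 = G 0) : F = G := by
  funext μ
  refine sub_eq_zero.1 (IsCornerFamily.eq_zero (D := fun μ => F μ - G μ) (fun ν j => ?_)
    (sub_eq_zero.2 h0) μ)
  linear_combination hF ν j - hG ν j

theorem uExt_succ {R : Type*} [One R] (u : Fin r → R) (j : Fin r) : uExt u (j + 1) = u j :=
  dif_pos j.2

theorem uExt_of_le {R : Type*} [One R] (u : Fin r → R) {j : ℕ} (h : r < j) : uExt u j = 1 := by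
  obtain ⟨j, rfl⟩ : ∃ i, j = i + 1 := ⟨j - 1, by omega⟩
  exact dif_neg (by omega)

theorem map_uExt {R S F : Type*} [One R] [One S] [FunLike F R S] [OneHomClass F R S] (φ : F)
    (u : Fin r → R) (j : ℕ) : φ (uExt u j) = uExt (fun i => φ (u i)) j := by
  cases j with
  | zero => exact map_one φ
  | succ j =>
    by_cases h : j < r
    · simp [uExt, h]
    · simp [uExt, h]

/-- The term `u_{i-1}` carries no small factor, so the gain in order is propagated by an inner
induction on the index, starting from `u_0 = 1`. -/
theorem IsCornerSolution.eq {σ : Type*} {ξ : Var r → MvPowerSeries σ K}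
    (hξ : ∀ v, MvPowerSeries.constantCoeff (ξ v) = 0) {u u' : Fin r → MvPowerSeries σ K}
    (hu : IsCornerSolution ξ u) (hu' : IsCornerSolution ξ u') : u = u' := by
  have key : ∀ j, uExt u j - uExt u' j = 0 := by
    refine eq_zero_of_forall_mem_orderIdeal _ fun n hn j => ?_
    induction j with
    | zero => simp [uExt]
    | succ j ih =>
      by_cases h : j < r
      · have e1 := hu ⟨j, h⟩
        have e2 := hu' ⟨j, h⟩
        have : uExt u (j + 1) - uExt u' (j + 1) = (uExt u j - uExt u' j) -
            ξ (Sum.inl ⟨j, h⟩) * (uExt u 1 * (uExt u (j + 1) - uExt u' (j + 1)) +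
              uExt u' (j + 1) * (uExt u 1 - uExt u' 1)) +
            sndExt ξ j * (uExt u (j + 2) - uExt u' (j + 2)) := by
          linear_combination e1 - e2
        rw [this]
        exact add_mem (sub_mem ih (mul_mem_orderIdeal (hξ _)
          (add_mem (Ideal.mul_mem_left _ _ (hn _)) (Ideal.mul_mem_left _ _ (hn _)))))
          (mul_mem_orderIdeal (constantCoeff_sndExt _ hξ _) (hn _))
      · rw [uExt_of_le u (by omega), uExt_of_le u' (by omega), sub_self]
        exact zero_mem _
  funext j
  have := key (j + 1)
  rwa [uExt_succ, uExt_succ, sub_eq_zero] at this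

theorem IsCornerSolution.constantCoeff_uExt {σ : Type*} {ξ : Var r → MvPowerSeries σ K}
    (hξ : ∀ v, MvPowerSeries.constantCoeff (ξ v) = 0) {u : Fin r → MvPowerSeries σ K}
    (hu : IsCornerSolution ξ u) (j : ℕ) : MvPowerSeries.constantCoeff (uExt u j) = 1 := by
  induction j with
  | zero => simp [uExt]
  | succ j ih =>
    by_cases h : j < r
    · have := hu ⟨j, h⟩
      rw [this]
      simp [ih, hξ, constantCoeff_sndExt ξ hξ]
    · rw [uExt_of_le u (by omega), map_one]

/-! ### The solution of the quadratic system -/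

section Solution

variable [CharZero K]

/-- As functions of `μ` both sides satisfy the corner recurrences, and they agree at `μ = 0`. -/
theorem cornerSum_add (μ ν : Fin r → ℤ) : cornerSum K (μ + ν) = cornerSum K μ * cornerSum K ν := by
  have hG := isCornerFamily_cornerSum (K := K) (r := r)
  have := IsCornerFamily.ext (F := fun μ => cornerSum K (μ + ν))
    (G := fun μ => cornerSum K μ * cornerSum K ν)
    (fun κ j => by
      have := hG (κ + ν) j
      beta_reduce
      rw [add_right_comm κ _ ν, this, add_right_comm κ ν, add_right_comm _ ν, add_right_comm _ ν])
    (fun κ j => by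
      have := hG κ j
      linear_combination cornerSum K ν * this) (by simp [cornerSum_zero])
  exact congrFun this μ

variable (K r) in
/-- `μ ↦ ∑_i ξ^{f_i} Φ(μ + ν^i)` as a homomorphism to the units. -/
noncomputable def cornerHom :
    Multiplicative (Fin r → ℤ) →* (Series K r)ˣ :=
  MonoidHom.toHomUnits
    { toFun := fun μ => cornerSum K μ.toAdd
      map_one' := cornerSum_zero
      map_mul' := fun μ ν => cornerSum_add μ.toAdd ν.toAdd }

theorem coe_cornerHom (μ : Fin r → ℤ) :
    (cornerHom K r (Multiplicative.ofAdd μ) : Series K r) = cornerSum K μ := rfl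

variable (K r) in
/-- The formal solution of the quadratic system. -/
noncomputable def cornerU (i : Fin r) : (Series K r)ˣ :=
  cornerHom K r (Multiplicative.ofAdd fun j => if j ≤ i then 1 else 0)

/-- The `j`-th coordinate of `∑_i k_i 1_{j ≤ i}` is a tail sum of `k`, which is how `π` arises. -/
theorem coe_prod_cornerU_zpow (k : Fin r → ℤ) :
    ((∏ i, cornerU K r i ^ k i : (Series K r)ˣ) : Series K r) = cornerSum K (piVec k) := by
  rw [← coe_cornerHom]
  congr 1
  simp only [cornerU, ← map_zpow, ← map_prod, ← ofAdd_zsmul, ← ofAdd_sum]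
  congr 2
  ext j
  simp [piVec, Finset.sum_apply, ← Finset.sum_filter, Finset.filter_le_eq_Ici]

theorem uExt_cornerU {n : ℕ} (hn : n ≤ r) :
    uExt (fun i => (cornerU K r i : Series K r)) n =
      cornerSum K (fun j => if (j : ℕ) < n then 1 else 0) := by
  cases n with
  | zero => simpa using! cornerSum_zero.symm
  | succ n =>
    rw [uExt, dif_pos (by omega), cornerU, coe_cornerHom]
    simp [Fin.le_def]

/-- Each quadratic equation is the recurrence at the indicator of `{j < i}` in direction `e_i`;
multiplicativity splits off the shift by `e_0` as the factor `u_1`. -/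
theorem isCornerSolution_cornerU :
    IsCornerSolution MvPowerSeries.X (fun i => (cornerU K r i : Series K r)) := by
  intro i
  have hv : ∀ n, (fun j : Fin r => if (j : ℕ) < n then (1 : ℤ) else 0) + unitVec r n =
      fun j : Fin r => if (j : ℕ) < n + 1 then 1 else 0 := fun n => by
    ext j
    simp only [unitVec, Pi.add_apply]
    split_ifs <;> omega
  have h := isCornerFamily_cornerSum (K := K) (fun j : Fin r => if (j : ℕ) < i then 1 else 0) i
  have h1 : unitVec r 0 = fun j : Fin r => if (j : ℕ) < 1 then 1 else 0 := by
    simp only [← hv 0]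
    ext
    simp
  rw [hv, hv, h1, cornerSum_add _ (fun j : Fin r => if (j : ℕ) < 1 then 1 else 0),
    ← uExt_cornerU i.2.le, ← uExt_cornerU i.2, ← uExt_cornerU (n := 1) i.pos] at h
  by_cases hi : (i : ℕ) < r - 1
  · rw [← uExt_cornerU (n := i + 2) (by omega)] at h
    linear_combination h
  · rw [sndExt_of_le _ (not_lt.1 hi)] at h ⊢
    linear_combination h

end Solution

end Corner

namespace Corner

variable {K : Type*} [Field K] {r : ℕ}

theorem map_sndExt {R S F : Type*} [Zero R] [Zero S] [FunLike F R S] [ZeroHomClass F R S] (φ : F)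
    (ξ : Var r → R) (j : ℕ) : φ (sndExt ξ j) = sndExt (fun v => φ (ξ v)) j := by
  unfold sndExt
  split_ifs
  · rfl
  · exact map_zero φ

theorem map_fstExt {R S F : Type*} [Zero R] [Zero S] [FunLike F R S] [ZeroHomClass F R S] (φ : F)
    (ξ : Var r → R) (j : ℕ) : φ (fstExt ξ j) = fstExt (fun v => φ (ξ v)) j := by
  unfold fstExt
  split_ifs
  · rfl
  · exact map_zero φ

/-! ### Horn's property and the Pochhammer form -/

section Horn

/-- The sum of the first family at `0`, and the second family shifted by one. -/
def prevExt {R : Type*} [AddCommMonoid R] (ξ : Var r → R) : ℕ → R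
  | 0 => ∑ i : Fin r, ξ (Sum.inl i)
  | j + 1 => sndExt ξ j

theorem cast_pPrev (q : Var r → ℕ) (j : ℕ) :
    (pPrev q j : K) = prevExt (fun v => (q v : K)) j := by
  cases j with
  | zero => simp [pPrev, prevExt]
  | succ j => exact map_sndExt (Nat.castRingHom K) q j

theorem map_prevExt {R S : Type*} [CommRing R] [CommRing S] (φ : R →+* S) (ξ : Var r → R) (j : ℕ) :
    φ (prevExt ξ j) = prevExt (fun v => φ (ξ v)) j := by
  cases j with
  | zero => simp [prevExt]
  | succ j => exact map_sndExt φ ξ j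

theorem pochFactor_comm (a : ℤ) (m p : ℕ) : pochFactor K a m p = pochFactor K a p m := by
  rw [pochFactor, pochFactor, add_comm, mul_comm (m.factorial : K)]

theorem mul_pochFactor_add_one (a : ℤ) (m p : ℕ) :
    (a : K) * pochFactor K (a + 1) m p = (a + m + p) * pochFactor K a m p := by
  rw [pochFactor, pochFactor, mul_div_assoc', mul_div_assoc', ← poch_succ_left, poch_succ]
  push_cast
  ring

theorem monoF_map {R S : Type*} [CommRing R] [CommRing S] (φ : R →+* S) (ξ : Var r → R) (i : ℤ) :
    φ (monoF ξ i) = monoF (fun v => φ (ξ v)) i := by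
  simp [monoF, map_prod, map_mul, map_pow, map_sndExt]

theorem prod_sndExt {R M : Type*} [Zero R] [CommMonoid M] (ξ : Var r → R) (f : R → M)
    (h0 : f 0 = 1) : ∏ j : Fin r, f (sndExt ξ j) = ∏ j : Fin (r - 1), f (ξ (Sum.inr j)) := by
  cases r with
  | zero => simp
  | succ n =>
    rw [Fin.prod_univ_castSucc, sndExt_of_le _ (by simp), h0, mul_one]
    exact Finset.prod_congr rfl fun j _ => by
      rw [Fin.val_castSucc]
      exact congrArg f (sndExt_apply (r := n + 1) ξ j)

variable [CharZero K]

theorem succ_mul_pochFactor (a : ℤ) (m p : ℕ) :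
    ((m : K) + 1) * pochFactor K a (m + 1) p = (a + m + p) * pochFactor K a m p := by
  have h1 : (m.factorial : K) ≠ 0 := Nat.cast_ne_zero.2 m.factorial_ne_zero
  have h2 : (p.factorial : K) ≠ 0 := Nat.cast_ne_zero.2 p.factorial_ne_zero
  have h3 : (m : K) + 1 ≠ 0 := Nat.cast_add_one_ne_zero m
  rw [pochFactor, pochFactor, show m + 1 + p = m + p + 1 by ring, poch_succ, Nat.factorial_succ]
  push_cast
  field_simp
  ring

/-- Exponents `d, k, l ∈ {0, 1}` treat all directions by one formula, so that the polynomials in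
Horn's condition can be written as products over the factors. -/
theorem pochFactor_shift (a : ℤ) (m p : ℕ) {d k l : ℕ} (hd : d ≤ 1) (hk : k ≤ 1) (hl : l ≤ 1) :
    (a : K) ^ d * ((m : K) + 1) ^ k * ((p : K) + 1) ^ l * pochFactor K (a + d) (m + k) (p + l) =
      ((a : K) + m + p) ^ d * ((a : K) + d + m + p) ^ k * ((a : K) + d + k + m + p) ^ l *
        pochFactor K a m p := by
  have h1 : (a : K) ^ d * pochFactor K (a + d) m p = ((a : K) + m + p) ^ d * pochFactor K a m p := by
    interval_cases d
    · simp
    · simpa using mul_pochFactor_add_one a m p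
  have h2 : ((m : K) + 1) ^ k * pochFactor K (a + d) (m + k) p =
      ((a : K) + d + m + p) ^ k * pochFactor K (a + d) m p := by
    interval_cases k
    · simp
    · simpa using succ_mul_pochFactor (a + d) m p
  have h3 : ((p : K) + 1) ^ l * pochFactor K (a + d) (m + k) (p + l) =
      ((a : K) + d + k + m + p) ^ l * pochFactor K (a + d) (m + k) p := by
    interval_cases l
    · simp
    · have := succ_mul_pochFactor (K := K) (a + d) p (m + k)
      rw [pochFactor_comm _ (p + 1), pochFactor_comm _ p] at this
      push_cast at this
      rw [pow_one, pow_one, this]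
      ring
  linear_combination (a : K) ^ d * ((m : K) + 1) ^ k * h3 +
    (a : K) ^ d * ((a : K) + d + k + m + p) ^ l * h2 +
    ((a : K) + d + m + p) ^ k * ((a : K) + d + k + m + p) ^ l * h1

theorem isHornSeries_Phi (μ : Fin r → ℤ) : IsHornSeries (Phi K r μ) := by
  intro v
  set e : Var r →₀ ℕ := Finsupp.single v 1 with he
  have hd : ∀ l : ℕ, pPrev e l ≤ 1 := fun l => by
    rcases v with v | v
    · rw [he, pPrev_single_inl]
      split_ifs <;> simp
    · rw [he, pPrev_single_inr]
      split_ifs <;> simp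
  have hk : ∀ l : Fin r, e (Sum.inl l) ≤ 1 := fun l => by
    rw [he, Finsupp.single_apply]
    split_ifs <;> simp
  have hl : ∀ l : ℕ, sndExt e l ≤ 1 := fun l => by
    rcases v with v | v
    · rw [he, sndExt_single_inl]
      simp
    · rw [he, sndExt_single_inr]
      split_ifs <;> simp
  let x : Var r → MvPolynomial (Var r) K := MvPolynomial.X
  let a : Fin r → MvPolynomial (Var r) K := fun l => MvPolynomial.C (μ l : K) + prevExt x l
  let P : MvPolynomial (Var r) K := MvPolynomial.C ((-1) ^ (∑ l : Fin r, e (Sum.inl l))) *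
    ∏ l : Fin r, ((a l + x (Sum.inl l) + sndExt x l) ^ pPrev e l *
      (a l + MvPolynomial.C (pPrev e l : K) + x (Sum.inl l) + sndExt x l) ^ e (Sum.inl l) *
      (a l + MvPolynomial.C (pPrev e l : K) + MvPolynomial.C (e (Sum.inl l) : K) + x (Sum.inl l) +
        sndExt x l) ^ sndExt e l)
  let Q : MvPolynomial (Var r) K := ∏ l : Fin r,
    (a l ^ pPrev e l * (x (Sum.inl l) + 1) ^ e (Sum.inl l) * (sndExt x l + 1) ^ sndExt e l)
  have hx : ∀ n : Var r → ℕ, (fun w => MvPolynomial.eval (fun w => (n w : K)) (x w)) =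
      fun w => (n w : K) := fun n => by
    ext w
    exact MvPolynomial.eval_X w
  have ha : ∀ (n : Var r → ℕ) l, MvPolynomial.eval (fun w => (n w : K)) (a l) =
      ((μ l + pPrev n l : ℤ) : K) := fun n l => by
    simp only [a]
    rw [map_add, MvPolynomial.eval_C, map_prevExt, hx, ← cast_pPrev]
    push_cast
    rfl
  have hs : ∀ (n : Var r → ℕ) (l : ℕ), MvPolynomial.eval (fun w => (n w : K)) (sndExt x l) =
      sndExt n l := fun n l => by
    rw [map_sndExt, hx]
    exact (map_sndExt (Nat.castRingHom K) n l).symm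
  have hP : ∀ n : Var r → ℕ, MvPolynomial.eval (fun w => (n w : K)) P =
      (-1) ^ (∑ l : Fin r, e (Sum.inl l)) *
      ∏ l : Fin r, ((((μ l + pPrev n l : ℤ) : K) + n (Sum.inl l) + sndExt n l) ^ pPrev e l *
      (((μ l + pPrev n l : ℤ) : K) + pPrev e l + n (Sum.inl l) + sndExt n l) ^ e (Sum.inl l) *
      (((μ l + pPrev n l : ℤ) : K) + pPrev e l + e (Sum.inl l) + n (Sum.inl l) +
        sndExt n l) ^ sndExt e l) := fun n => by
    simp only [P, map_mul, map_prod, map_pow, map_add, ha, hs, MvPolynomial.eval_C]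
    simp only [x, MvPolynomial.eval_X]
  have hQ : ∀ n : Var r → ℕ, MvPolynomial.eval (fun w => (n w : K)) Q =
      ∏ l : Fin r, (((μ l + pPrev n l : ℤ) : K) ^ pPrev e l *
      ((n (Sum.inl l) : K) + 1) ^ e (Sum.inl l) * (((sndExt n l : ℕ) : K) + 1) ^ sndExt e l) := fun n => by
    simp only [Q, map_mul, map_prod, map_pow, map_add, ha, hs, map_one]
    simp only [x, MvPolynomial.eval_X]
  -- A point with all `μ_l + p_{l-1}` positive: neither `P` nor `Q` vanishes there, so both are
  -- nonzero polynomials.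
  obtain ⟨n, hn⟩ : ∃ n : Var r → ℕ, ∀ l, 0 < μ l + pPrev n l := by
    refine ⟨fun _ => 1 + ∑ l, (μ l).natAbs, fun l => ?_⟩
    have h1 : (μ l).natAbs ≤ ∑ l, (μ l).natAbs :=
      Finset.single_le_sum (f := fun l => (μ l).natAbs) (fun _ _ => Nat.zero_le _)
        (Finset.mem_univ l)
    have h2 : 1 + ∑ l, (μ l).natAbs ≤ pPrev (fun _ : Var r => 1 + ∑ l, (μ l).natAbs) l := by
      obtain ⟨l, h⟩ := l
      cases l with
      | zero =>
        simp only [pPrev, Finset.sum_const, Finset.card_univ, Fintype.card_fin, smul_eq_mul]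
        exact Nat.le_mul_of_pos_left _ h
      | succ l => simp [pPrev, sndExt, show l < r - 1 by omega]
    omega
  refine ⟨P, Q, fun h => ?_, fun h => ?_, fun n => ?_⟩
  · have := hP n
    rw [h, map_zero] at this
    refine mul_ne_zero (pow_ne_zero _ (neg_ne_zero.2 one_ne_zero)) (Finset.prod_ne_zero_iff.2
      fun l _ => mul_ne_zero (mul_ne_zero (pow_ne_zero _ ?_) (pow_ne_zero _ ?_))
        (pow_ne_zero _ ?_)) this.symm
    all_goals
      have := hn l
      norm_cast
      omega
  · have := hQ n
    rw [h, map_zero] at this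
    refine Finset.prod_ne_zero_iff.2 (fun l _ => mul_ne_zero (mul_ne_zero (pow_ne_zero _ ?_)
      (pow_ne_zero _ (Nat.cast_add_one_ne_zero _))) (pow_ne_zero _ (Nat.cast_add_one_ne_zero _)))
      this.symm
    exact Int.cast_ne_zero.2 (hn l).ne'
  · rw [hP, hQ, coeff_Phi, coeff_Phi]
    have : ∀ l : Fin r, _ := fun l => pochFactor_shift (K := K) (μ l + pPrev n l) (n (Sum.inl l))
      (sndExt n l) (hd l) (hk l) (hl l)
    have := Finset.prod_congr (rfl : (Finset.univ : Finset (Fin r)) = _) fun l _ => this l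
    simp only [Finset.prod_mul_distrib] at this
    simp only [Finset.prod_mul_distrib, Finsupp.add_apply, Finset.sum_add_distrib, pow_add, pPrev_add,
      sndExt_add, Nat.cast_add, ← add_assoc]
    linear_combination (-1) ^ (∑ l : Fin r, n (Sum.inl l)) *
      (-1) ^ (∑ l : Fin r, e (Sum.inl l)) * this

/-- Splitting `(μ_j)_{p_{j-1} + m_j + p_j}` after the first `p_{j-1}` factors leaves `(μ_j +
p_{j-1})_{m_j + p_j}`; positivity of `μ_j` makes the denominator nonzero. -/
theorem Phi_eq_PhiPoch {μ : Fin r → ℤ} (hμ : ∀ j, 1 ≤ μ j) : Phi K r μ = PhiPoch K r μ := by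
  ext q
  rw [coeff_Phi]
  change _ = PhiPoch K r μ q
  rw [PhiPoch, Fintype.prod_sum_type,
    ← prod_sndExt (q : Var r → ℕ) (fun n => (n.factorial : K)) (by simp), ← Finset.prod_mul_distrib,
    div_eq_mul_inv, mul_assoc, ← Finset.prod_inv_distrib, ← Finset.prod_mul_distrib]
  congr 1
  refine Finset.prod_congr rfl fun j _ => ?_
  have h : poch K (μ j) (pPrev q j) ≠ 0 := Finset.prod_ne_zero_iff.2 fun t _ => by
    have := hμ j
    norm_cast
    omega
  rw [add_comm _ (pPrev q j), poch_add, mul_div_cancel_left₀ _ h, pochFactor, div_eq_inv_mul]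

end Horn

/-! ### The Lagrange-type equations -/

section Lagrange

theorem coe_uExt {R : Type*} [CommRing R] (u : Fin r → Rˣ) (j : ℕ) :
    ((uExt u j : Rˣ) : R) = uExt (fun i => (u i : R)) j :=
  map_uExt (Units.coeHom R) u j

theorem constantCoeff_sVar (j : ℕ) : MvPowerSeries.constantCoeff (sVar K r j) = 0 := by
  unfold sVar fstExt
  split_ifs
  · exact MvPowerSeries.constantCoeff_X _
  · simp

theorem constantCoeff_wVar (j : ℕ) : MvPowerSeries.constantCoeff (wVar K r j) = 0 :=
  constantCoeff_sndExt _ (fun v => MvPowerSeries.constantCoeff_X v) _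

theorem X_mul_subst_phi {u : Fin r → (Series K r)ˣ}
    (hu : IsCornerSolution MvPowerSeries.X fun i => (u i : Series K r)) (v : Var r) :
    MvPowerSeries.X v * MvPowerSeries.subst (etaOf MvPowerSeries.X u) (phi K r v) =
      etaOf MvPowerSeries.X u v := by
  have hη : MvPowerSeries.HasSubst (etaOf MvPowerSeries.X u) :=
    MvPowerSeries.hasSubst_of_constantCoeff_zero fun v => by
      rcases v with v | v <;> simp [etaOf]
  set η := etaOf MvPowerSeries.X u with hη_def
  set Ψ := MvPowerSeries.substAlgHom (R := K) hη with hΨ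
  have hX : ∀ v, Ψ (MvPowerSeries.X v) = η v := fun v => MvPowerSeries.substAlgHom_X hη v
  -- The quadratic system reads `u_{j+1}(1 + s_j) = u_j(1 + w_j)`, so `ρ j = u_{j+1}/u_j`. Then `f`
  -- becomes `ρ 0 = u_1` and `h_i` becomes `ρ i * ρ (i+1) = u_{i+2}/u_i`.
  set ρ : ℕ → Series K r := fun j => Ψ ((1 + wVar K r j) * (1 + sVar K r j)⁻¹) with hρ
  have hρu : ∀ j < r, ρ j * ((uExt u j : (Series K r)ˣ) : Series K r) =
      ((uExt u (j + 1) : (Series K r)ˣ) : Series K r) := by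
    intro j hj
    have h1 : (1 + Ψ (sVar K r j)) * Ψ (1 + sVar K r j)⁻¹ = 1 := by
      have : (1 + sVar K r j) * (1 + sVar K r j)⁻¹ = 1 :=
        MvPowerSeries.mul_inv_cancel _ (by simp [constantCoeff_sVar])
      have h := congrArg Ψ this
      rwa [map_mul, map_add, map_one] at h
    have h2 : Ψ (sVar K r j) =
        MvPowerSeries.X (Sum.inl ⟨j, hj⟩ : Var r) * ((uExt u 1 : (Series K r)ˣ) : Series K r) := by
      rw [sVar, map_fstExt, funext hX, fstExt_apply η ⟨j, hj⟩, hη_def]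
      rfl
    have h3 : Ψ (wVar K r j) * ((uExt u j : (Series K r)ˣ) : Series K r) =
        sndExt (MvPowerSeries.X : Var r → Series K r) j *
          ((uExt u (j + 2) : (Series K r)ˣ) : Series K r) := by
      rw [wVar, map_sndExt, funext hX]
      by_cases h : j < r - 1
      · rw [sndExt_apply η ⟨j, h⟩, sndExt_apply _ ⟨j, h⟩, hη_def]
        simp only [etaOf, Units.val_mul]
        rw [mul_assoc, mul_assoc, Units.inv_mul, mul_one]
      · rw [sndExt_of_le _ (not_lt.1 h), sndExt_of_le _ (not_lt.1 h), zero_mul, zero_mul]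
    have h4 := hu ⟨j, hj⟩
    simp only [← coe_uExt] at h4
    simp only [hρ, map_mul, map_add, map_one]
    rw [h2] at h1
    linear_combination (Ψ (1 + sVar K r j)⁻¹) * (h3 - h4) +
      ((uExt u (j + 1) : (Series K r)ˣ) : Series K r) * h1
  rw [← MvPowerSeries.substAlgHom_apply hη]
  rcases v with i | i
  · have := hρu 0 i.pos
    simp only [uExt, Units.val_one, mul_one] at this
    change MvPowerSeries.X _ * ρ 0 = MvPowerSeries.X _ * _
    rw [this]
    rfl
  · have h1 := hρu i (by omega)
    have h2 := hρu (i + 1) (by omega)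
    have h3 : Ψ (phi K r (Sum.inr i)) = ρ i * ρ (i + 1) := by
      simp only [hρ]
      rw [← map_mul, phi, MvPowerSeries.mul_inv_rev]
      congr 1
      ring
    change _ = MvPowerSeries.X _ * _
    rw [h3, Units.val_mul, (Units.eq_mul_inv_iff_mul_eq (uExt u (i : ℕ)) (a := ρ i * ρ (i + 1))
      (b := ((uExt u (i + 2) : (Series K r)ˣ) : Series K r))).2]
    linear_combination ρ (i + 1) * h1 + h2

end Lagrange

end Corner

namespace Corner

variable {K : Type*} [Field K] {r : ℕ}

/-! ### The eigenvalue problem -/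

section Branch

theorem jacobiMatrix_mulVec_zero {R : Type*} [CommRing R] (hr : 0 < r) (α : Fin (r + 1) → R)
    (b c : Fin r → R) (V : Fin (r + 1) → R) :
    (jacobiMatrix α b c).mulVec V 0 = α 0 * V 0 + b ⟨0, hr⟩ * V ⟨1, by omega⟩ := by
  have h : ∀ k, jacobiMatrix α b c 0 k * V k = (if k = 0 then α 0 * V 0 else 0) +
      if k = ⟨1, by omega⟩ then b ⟨0, hr⟩ * V ⟨1, by omega⟩ else 0 := by
    intro k
    simp only [jacobiMatrix, Matrix.of_apply]
    by_cases h0 : k = 0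
    · subst h0
      rw [if_pos rfl, if_pos rfl, if_neg (by simp [Fin.ext_iff]), add_zero]
    · rw [if_neg (Ne.symm h0), if_neg h0, zero_add]
      by_cases h1 : k = ⟨1, by omega⟩
      · subst h1
        simp
      · have : ¬ (0 + 1 = (k : ℕ)) := fun h => h1 (Fin.ext h.symm)
        simp [h1, this]
  simp only [Matrix.mulVec, dotProduct, h, Finset.sum_add_distrib, Finset.sum_ite_eq',
    Finset.mem_univ, if_true]

theorem jacobiMatrix_mulVec_succ {R : Type*} [CommRing R] (α : Fin (r + 1) → R)
    (b c : Fin r → R) (V : Fin (r + 1) → R) (j : Fin r) :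
    (jacobiMatrix α b c).mulVec V j.succ = c j * V j.castSucc + α j.succ * V j.succ +
      if h : (j : ℕ) + 1 < r then b ⟨j + 1, h⟩ * V ⟨j + 2, by omega⟩ else 0 := by
  have h : ∀ k, jacobiMatrix α b c j.succ k * V k =
      (if k = j.castSucc then c j * V j.castSucc else 0) +
      (if k = j.succ then α j.succ * V j.succ else 0) +
      if h : (j : ℕ) + 1 < r then
        if k = ⟨j + 2, by omega⟩ then b ⟨j + 1, h⟩ * V ⟨j + 2, by omega⟩ else 0
      else 0 := by
    intro k
    simp only [jacobiMatrix, Matrix.of_apply]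
    by_cases h0 : k = j.succ
    · subst h0
      have h1 : j.succ ≠ j.castSucc := by simp [Fin.ext_iff]
      simp [h1, Fin.ext_iff]
    · rw [if_neg (Ne.symm h0), if_neg h0, add_zero]
      have hk := k.2
      by_cases h1 : k = j.castSucc
      · subst h1
        rw [if_pos rfl, dif_neg (by simp; omega), dif_pos (by simp)]
        simp [Fin.ext_iff]
      · have h1' : ¬ (k : ℕ) = j := fun h => h1 (Fin.ext h)
        rw [if_neg h1, zero_add]
        by_cases h2 : (k : ℕ) = j + 2
        · have h3 : (j : ℕ) + 1 < r := by omega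
          have h4 : k = ⟨j + 2, Nat.succ_lt_succ h3⟩ := Fin.ext h2
          subst h4
          simp [h3]
        · rw [dif_neg (by simp; omega), dif_neg (by simp; omega), zero_mul]
          simp [Fin.ext_iff, h2]
  simp only [Matrix.mulVec, dotProduct, h, Finset.sum_add_distrib, Finset.sum_ite_eq',
    Finset.mem_univ, if_true]
  congr 1
  split_ifs <;> simp

theorem IsCornerBranch.eigenvalue_eq (hr : 0 < r) {α : Fin (r + 1) → K} {lam : OffDiagSeries K r}
    {V : Fin (r + 1) → OffDiagSeries K r} (h : IsCornerBranch α lam V) :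
    lam = MvPowerSeries.C (α 0) + bVar K r ⟨0, hr⟩ * V ⟨1, by omega⟩ := by
  have := congrFun h.eigen 0
  rw [jacobiMatrix_mulVec_zero hr, Pi.smul_apply, h.normalized, smul_eq_mul, mul_one, mul_one] at this
  exact this.symm

theorem constantCoeff_bVar (j : Fin r) : MvPowerSeries.constantCoeff (bVar K r j) = 0 :=
  MvPowerSeries.constantCoeff_X _

theorem constantCoeff_cVar (j : Fin r) : MvPowerSeries.constantCoeff (cVar K r j) = 0 :=
  MvPowerSeries.constantCoeff_X _

/-- With `Λ = α_0 + b_0 V_1` inserted, row `j ≥ 1` expresses `(α_j - α_0)V_j` by terms containing an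
off-diagonal element. Differences therefore gain an order, and `α_j - α_0` is invertible. -/
theorem IsCornerBranch.eq (hr : 0 < r) {α : Fin (r + 1) → K} (hα : ∀ i, i ≠ 0 → α i ≠ α 0)
    {lam lam' : OffDiagSeries K r} {V V' : Fin (r + 1) → OffDiagSeries K r}
    (h : IsCornerBranch α lam V) (h' : IsCornerBranch α lam' V') : lam = lam' ∧ V = V' := by
  have hV : V = V' := by
    have key : ∀ j, V j - V' j = 0 := by
      refine eq_zero_of_forall_mem_orderIdeal _ fun n hn j => ?_
      refine Fin.cases ?_ (fun j => ?_) j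
      · rw [h.normalized, h'.normalized, sub_self]
        exact zero_mem _
      · have e1 := congrFun h.eigen j.succ
        have e2 := congrFun h'.eigen j.succ
        rw [jacobiMatrix_mulVec_succ, Pi.smul_apply, smul_eq_mul, h.eigenvalue_eq hr] at e1
        rw [jacobiMatrix_mulVec_succ, Pi.smul_apply, smul_eq_mul, h'.eigenvalue_eq hr] at e2
        have ha : α j.succ - α 0 ≠ 0 := sub_ne_zero.2 (hα _ (Fin.succ_ne_zero j))
        have hC : (MvPowerSeries.C (α j.succ - α 0)⁻¹ : OffDiagSeries K r) *
            (MvPowerSeries.C (α j.succ) - MvPowerSeries.C (α 0)) = 1 := by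
          rw [← map_sub, ← map_mul, inv_mul_cancel₀ ha, map_one]
        have hrest : (if h : (j : ℕ) + 1 < r then bVar K r ⟨j + 1, h⟩ * V ⟨j + 2, by omega⟩ else 0) -
            (if h : (j : ℕ) + 1 < r then bVar K r ⟨j + 1, h⟩ * V' ⟨j + 2, by omega⟩ else 0) ∈
            orderIdeal _ K (n + 1) := by
          split_ifs with hj
          · rw [← mul_sub]
            exact mul_mem_orderIdeal (constantCoeff_bVar _) (hn _)
          · rw [sub_self]
            exact zero_mem _
        have hmem : (MvPowerSeries.C (α j.succ) - MvPowerSeries.C (α 0)) * (V j.succ - V' j.succ) ∈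
            orderIdeal (Fin r ⊕ Fin r) K (n + 1) := by
          have : (MvPowerSeries.C (α j.succ) - MvPowerSeries.C (α 0)) * (V j.succ - V' j.succ) =
              bVar K r ⟨0, hr⟩ * (V ⟨1, by omega⟩ * (V j.succ - V' j.succ) +
                V' j.succ * (V ⟨1, by omega⟩ - V' ⟨1, by omega⟩)) -
              cVar K r j * (V j.castSucc - V' j.castSucc) -
              ((if h : (j : ℕ) + 1 < r then bVar K r ⟨j + 1, h⟩ * V ⟨j + 2, by omega⟩ else 0) -
              (if h : (j : ℕ) + 1 < r then bVar K r ⟨j + 1, h⟩ * V' ⟨j + 2, by omega⟩ else 0)) := by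
            linear_combination e1 - e2
          rw [this]
          exact sub_mem (sub_mem (mul_mem_orderIdeal (constantCoeff_bVar _)
            (add_mem (Ideal.mul_mem_left _ _ (hn _)) (Ideal.mul_mem_left _ _ (hn _))))
            (mul_mem_orderIdeal (constantCoeff_cVar _) (hn _))) hrest
        have := Ideal.mul_mem_left _ (MvPowerSeries.C (α j.succ - α 0)⁻¹) hmem
        rwa [← mul_assoc, hC, one_mul] at this
    funext j
    exact sub_eq_zero.1 (key j)
  refine ⟨?_, hV⟩
  rw [h.eigenvalue_eq hr, h'.eigenvalue_eq hr, hV]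

/-! ### Scaling identities linking the eigenvector rows to the quadratic system. -/

section Scaling

variable {R : Type*} [CommRing R] [Algebra K R] {a : Fin r → K} (b c : Fin r → R)

theorem prod_Iic_succ {M : Type*} [CommMonoid M] (f : Fin r → M) {j : ℕ} (hj : j + 1 < r) :
    ∏ i ∈ Finset.Iic (⟨j + 1, hj⟩ : Fin r), f i =
      (∏ i ∈ Finset.Iic (⟨j, by omega⟩ : Fin r), f i) * f ⟨j + 1, hj⟩ := by
  have : Finset.Iic (⟨j + 1, hj⟩ : Fin r) =
      insert ⟨j + 1, hj⟩ (Finset.Iic (⟨j, by omega⟩ : Fin r)) := by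
    ext x
    simp only [Finset.mem_Iic, Finset.mem_insert, Fin.le_def, Fin.ext_iff]
    omega
  rw [this, Finset.prod_insert (by simp [Fin.le_def]), mul_comm]

theorem prod_Iic_zero {M : Type*} [CommMonoid M] (f : Fin r → M) (hr : 0 < r) :
    ∏ i ∈ Finset.Iic (⟨0, hr⟩ : Fin r), f i = f ⟨0, hr⟩ := by
  have : Finset.Iic (⟨0, hr⟩ : Fin r) = {⟨0, hr⟩} := by
    ext x
    simp [Fin.le_def, Fin.ext_iff]
  rw [this, Finset.prod_singleton]

variable (ha : ∀ j, a j ≠ 0)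

include ha in
theorem smul_vZero_zero (hr : 0 < r) : a ⟨0, hr⟩ • vZero a c ⟨0, hr⟩ = -c ⟨0, hr⟩ := by
  rw [vZero, prod_Iic_zero, prod_Iic_zero, smul_smul]
  have : a ⟨0, hr⟩ * ((-1) ^ (0 + 1) * (a ⟨0, hr⟩)⁻¹) = -1 := by
    have := ha ⟨0, hr⟩
    field_simp
    simp
  rw [this, neg_one_smul]

include ha in
theorem smul_vZero_succ {j : ℕ} (hj : j + 1 < r) : a ⟨j + 1, hj⟩ • vZero a c ⟨j + 1, hj⟩ =
    -(c ⟨j + 1, hj⟩ * vZero a c ⟨j, by omega⟩) := by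
  rw [vZero, vZero, prod_Iic_succ, prod_Iic_succ, smul_smul, mul_smul_comm, ← neg_smul,
    mul_comm (c _)]
  congr 1
  have := ha ⟨j + 1, hj⟩
  rw [mul_inv]
  field_simp
  ring

include ha in
theorem smul_xi_inl (j : Fin r) :
    a j • xi a b c (Sum.inl j) = -(b ⟨0, j.pos⟩ * vZero a c ⟨0, j.pos⟩) := by
  rw [xi, vZero, prod_Iic_zero, prod_Iic_zero, smul_smul, mul_smul_comm, ← neg_smul]
  congr 1
  have := ha j
  have := ha ⟨0, j.pos⟩
  field_simp
  simp

include ha in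
theorem smul_vZero_mul_xi_inr (j : Fin (r - 1)) :
    a ⟨j, by omega⟩ • (vZero a c ⟨j, by omega⟩ * xi a b c (Sum.inr j)) =
      -(b ⟨j + 1, by omega⟩ * vZero a c ⟨j + 1, by omega⟩) := by
  rw [xi, vZero, vZero, prod_Iic_succ, prod_Iic_succ, smul_mul_smul_comm, smul_smul,
    mul_smul_comm, ← neg_smul]
  have e : a ⟨j, by omega⟩ * ((-1) ^ ((j : ℕ) + 1) * (∏ i ∈ Finset.Iic ⟨j, by omega⟩, a i)⁻¹ *
      (a ⟨j, by omega⟩ * a ⟨j + 1, by omega⟩)⁻¹) = -((-1) ^ ((j : ℕ) + 1 + 1) *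
      ((∏ i ∈ Finset.Iic ⟨j, by omega⟩, a i) * a ⟨j + 1, by omega⟩)⁻¹) := by
    have := ha ⟨j, by omega⟩
    rw [mul_inv, mul_inv]
    field_simp
    ring
  rw [e]
  congr 1
  ring

end Scaling

theorem constantCoeff_xi (a : Fin r → K) (v : Var r) :
    MvPowerSeries.constantCoeff (xi a (bVar K r) (cVar K r) v) = 0 := by
  rcases v with v | v <;> simp [xi, constantCoeff_bVar]

theorem isCornerBranch_of_isCornerSolution (hr : 0 < r) {α : Fin (r + 1) → K}
    (hα : ∀ i, i ≠ 0 → α i ≠ α 0) {U : Fin r → OffDiagSeries K r}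
    (hU : IsCornerSolution (xi (fun i => α i.succ - α 0) (bVar K r) (cVar K r)) U)
    {V : Fin (r + 1) → OffDiagSeries K r} (hV0 : V 0 = 1)
    (hV : ∀ j : Fin r, V j.succ = vZero (fun i => α i.succ - α 0) (cVar K r) j * U j) :
    IsCornerBranch α (MvPowerSeries.C (α 0) + bVar K r ⟨0, hr⟩ * V ⟨1, by omega⟩) V := by
  set a : Fin r → K := fun i => α i.succ - α 0 with ha_def
  have ha : ∀ j, a j ≠ 0 := fun j => sub_ne_zero.2 (hα _ (Fin.succ_ne_zero j))
  set v : Fin r → OffDiagSeries K r := vZero a (cVar K r)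
  set ξ := xi a (bVar K r) (cVar K r)
  refine ⟨?_, hV0, ?_, ?_⟩
  · funext j
    refine Fin.cases ?_ (fun j => ?_) j
    · rw [jacobiMatrix_mulVec_zero hr, Pi.smul_apply, hV0, smul_eq_mul, mul_one, mul_one]
    · rw [jacobiMatrix_mulVec_succ, Pi.smul_apply, smul_eq_mul]
      have hj := hU j
      have h1 : (⟨1, by omega⟩ : Fin (r + 1)) = Fin.succ ⟨0, hr⟩ := rfl
      have hu1 : uExt U 1 = U ⟨0, hr⟩ := uExt_succ U ⟨0, hr⟩
      rw [uExt_succ, hu1] at hj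
      have s1 := smul_xi_inl (bVar K r) (cVar K r) ha j
      have s2 : a j • v j * uExt U j = -(cVar K r j * V j.castSucc) := by
        obtain ⟨j, hjr⟩ := j
        cases j with
        | zero =>
          rw [smul_vZero_zero (cVar K r) ha hr]
          change -_ * 1 = -(_ * V 0)
          rw [hV0, mul_one, mul_one]
        | succ j =>
          have h2 : (⟨j + 1, hjr⟩ : Fin r).castSucc = Fin.succ ⟨j, by omega⟩ := rfl
          have h3 : uExt U (j + 1) = U ⟨j, by omega⟩ := uExt_succ U ⟨j, by omega⟩
          rw [smul_vZero_succ (cVar K r) ha hjr, h2, hV, h3]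
          ring
      have s3 : a j • (v j * sndExt ξ j) * uExt U (j + 2) =
          -(if h : (j : ℕ) + 1 < r then bVar K r ⟨j + 1, h⟩ * V ⟨j + 2, by omega⟩ else 0) := by
        by_cases h : (j : ℕ) < r - 1
        · have h2 : (⟨j + 2, by omega⟩ : Fin (r + 1)) = Fin.succ ⟨j + 1, by omega⟩ := rfl
          have h3 : uExt U (j + 2) = U ⟨j + 1, by omega⟩ := uExt_succ U ⟨j + 1, by omega⟩
          rw [dif_pos (by omega), h2, hV, sndExt_apply ξ ⟨j, h⟩, h3,
            smul_vZero_mul_xi_inr (bVar K r) (cVar K r) ha ⟨j, h⟩]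
          ring
        · rw [dif_neg (by omega), sndExt_of_le _ (not_lt.1 h), mul_zero, smul_zero, zero_mul,
            neg_zero]
      rw [h1, hV, hV]
      simp only [MvPowerSeries.smul_eq_C_mul] at s1 s2 s3
      have hC : (MvPowerSeries.C (α j.succ) : OffDiagSeries K r) =
          MvPowerSeries.C (a j) + MvPowerSeries.C (α 0) := by
        rw [← map_add]
        simp [ha_def]
      rw [hC]
      -- Row `j + 1` is the quadratic equation multiplied by `a_{j+1} v_{j+1}^0`; `s1`, `s2`, `s3`
      -- convert the `x`-term, the `u_j`-term and the `z`-term.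
      linear_combination MvPowerSeries.C (a j) * v j * hj + s2 + s3 - v j * U ⟨0, hr⟩ * U j * s1
  · simp [constantCoeff_bVar]
  · intro j
    refine Fin.cases (fun h => absurd rfl h) (fun j _ => ?_) j
    have hs : MvPowerSeries.constantCoeff (∏ i ∈ Finset.Iic j, cVar K r i) = 0 := by
      rw [map_prod]
      exact Finset.prod_eq_zero (Finset.mem_Iic.2 le_rfl) (constantCoeff_cVar j)
    rw [hV, map_mul]
    simp only [v, vZero, MvPowerSeries.smul_eq_C_mul, map_mul, hs, mul_zero, zero_mul]

theorem IsCornerSolution.map {R S : Type*} [CommRing R] [CommRing S] (φ : R →+* S) {ξ : Var r → R}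
    {u : Fin r → R} (hu : IsCornerSolution ξ u) :
    IsCornerSolution (fun v => φ (ξ v)) fun i => φ (u i) := by
  intro i
  have := congrArg φ (hu i)
  simpa only [map_add, map_sub, map_mul, map_uExt, map_sndExt] using this

end Branch

end Corner

namespace Corner

variable {K : Type*} [Field K] {r : ℕ}

/-! ### Algebraic independence of the variables -/

section Independence

/-- The expansion variables over a ring in which the `a_i` are units. -/
def xiUnits {R : Type*} [CommRing R] (a : Fin r → Rˣ) (b c : Fin r → R) : Var r → R
  | Sum.inl i => ((a ⟨0, i.pos⟩ * a i)⁻¹ : Rˣ) * (b ⟨0, i.pos⟩ * c ⟨0, i.pos⟩)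
  | Sum.inr i => ((a ⟨i, by omega⟩ * a ⟨i + 1, by omega⟩)⁻¹ : Rˣ) *
      (b ⟨i + 1, by omega⟩ * c ⟨i + 1, by omega⟩)

theorem map_xiUnits {R F : Type*} [CommRing R] [Field F] (φ : R →+* F) (a : Fin r → Rˣ)
    (b c : Fin r → R) (v : Var r) :
    φ (xiUnits a b c v) =
      xi (K := F) (fun i => φ (a i)) (fun i => φ (b i)) (fun i => φ (c i)) v := by
  rcases v with v | v <;> simp [xiUnits, xi, map_units_inv]

/-- Values of `a_i`, `b_i`, `c_i` at which the expansion variables are the given `t_v`. -/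
def specialValue {F : Type*} [Field F] (t : Var r → F) (p : Fin 3 × Fin r) : F :=
  -- The choice `a_1 = 1`, `c = 1`, `b_0 = t_{x_0}` forces `a_{i+1} = t_{x_0}/t_{x_i}`; each
  -- remaining `b_{i+1}` is then solved from the equation for `z_i`.
  if p.1 = 0 then fstExt t 0 / fstExt t p.2
  else if p.1 = 1 then
    (if (p.2 : ℕ) = 0 then fstExt t 0 else
      sndExt t (p.2 - 1) * (fstExt t 0 / fstExt t (p.2 - 1 : ℕ) * (fstExt t 0 / fstExt t p.2)))
  else 1

theorem specialValue_zero_ne_zero {F : Type*} [Field F] {t : Var r → F} (ht : ∀ v, t v ≠ 0)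
    (i : Fin r) : specialValue t (0, i) ≠ 0 := by
  simp only [specialValue, if_true]
  rw [fstExt_apply t i, show fstExt t 0 = t (Sum.inl ⟨0, i.pos⟩) from fstExt_apply t ⟨0, i.pos⟩]
  exact div_ne_zero (ht _) (ht _)

theorem xi_specialValue {F : Type*} [Field F] {t : Var r → F} (ht : ∀ v, t v ≠ 0) (v : Var r) :
    xi (K := F) (fun i => specialValue t (0, i)) (fun i => specialValue t (1, i))
      (fun i => specialValue t (2, i)) v = t v := by
  have h2 : ∀ i : Fin r, specialValue t (2, i) = 1 := fun i => by simp [specialValue]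
  rcases v with i | i
  · have h0 : fstExt t 0 = t (Sum.inl ⟨0, i.pos⟩) := fstExt_apply t ⟨0, i.pos⟩
    have hi := fstExt_apply t i
    have := ht (Sum.inl ⟨0, i.pos⟩)
    have := ht (Sum.inl i)
    simp only [xi, h2]
    simp only [specialValue, if_true, one_ne_zero, if_false, h0, hi, smul_eq_mul]
    field_simp
  · have h1 := specialValue_zero_ne_zero ht ⟨i, by omega⟩
    have h3 := specialValue_zero_ne_zero ht ⟨i + 1, by omega⟩
    have hb : specialValue t (1, ⟨i + 1, by omega⟩) = t (Sum.inr i) *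
        (specialValue t (0, ⟨i, by omega⟩) * specialValue t (0, ⟨i + 1, by omega⟩)) := by
      simp [specialValue, sndExt_apply]
    simp only [xi, h2, hb, smul_eq_mul]
    field_simp

/-- A relation between the variables would survive the specialisation, which sends them to
independent elements `t`. -/
theorem algebraicIndependent_xi :
    AlgebraicIndependent K
      (xi (K := FractionRing (MvPolynomial (Fin 3 × Fin r) K))
        (R := FractionRing (MvPolynomial (Fin 3 × Fin r) K))
        (fun i => algebraMap (MvPolynomial (Fin 3 × Fin r) K) _ (MvPolynomial.X (0, i)))
        (fun i => algebraMap (MvPolynomial (Fin 3 × Fin r) K) _ (MvPolynomial.X (1, i)))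
        (fun i => algebraMap (MvPolynomial (Fin 3 × Fin r) K) _ (MvPolynomial.X (2, i)))) := by
  let A := MvPolynomial (Fin 3 × Fin r) K
  let L := FractionRing A
  let B := MvPolynomial (Var r) K
  let F := FractionRing B
  let t : Var r → F := fun v => algebraMap B F (MvPolynomial.X v)
  have ht : ∀ v, t v ≠ 0 := fun v =>
    (map_ne_zero_iff _ (IsFractionRing.injective B F)).2 (MvPolynomial.X_ne_zero v)
  have htind : AlgebraicIndependent K t :=
    (MvPolynomial.algebraicIndependent_X (Var r) K).map' (f := IsScalarTower.toAlgHom K B F)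
      (IsFractionRing.injective B F)
  let e : A →ₐ[K] F := MvPolynomial.aeval (specialValue t)
  have he : ∀ p, e (MvPolynomial.X p) = specialValue t p := fun p => MvPolynomial.aeval_X _ p
  let D : A := ∏ i : Fin r, MvPolynomial.X (0, i)
  have hD : D ≠ 0 := Finset.prod_ne_zero_iff.2 fun i _ => MvPolynomial.X_ne_zero _
  have heD : IsUnit (e D) := by
    rw [isUnit_iff_ne_zero, map_prod]
    refine Finset.prod_ne_zero_iff.2 fun i _ => ?_
    rw [he]
    exact specialValue_zero_ne_zero ht i
  have hLD : IsUnit (IsScalarTower.toAlgHom K A L D) :=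
    isUnit_iff_ne_zero.2 ((map_ne_zero_iff _ (IsFractionRing.injective A L)).2 hD)
  -- The specialisation need not extend to the whole fraction field, as denominators may be sent to
  -- zero. Inverting only `∏ a_i` suffices to define the variables, and this ring embeds in the
  -- fraction field.
  let Loc := Localization.Away D
  let ψ : Loc →ₐ[K] F := IsLocalization.Away.liftAlgHom (S := Loc) D (f := e) heD
  let ι : Loc →ₐ[K] L :=
    IsLocalization.Away.liftAlgHom (S := Loc) D (f := IsScalarTower.toAlgHom K A L) hLD
  have hψ : ∀ p, ψ (algebraMap A Loc p) = e p := fun p => IsLocalization.Away.lift_eq D heD p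
  have hι : ∀ p, ι (algebraMap A Loc p) = algebraMap A L p :=
    fun p => IsLocalization.Away.lift_eq D hLD p
  have hιinj : Function.Injective ι := by
    refine (IsLocalization.lift_injective_iff (S := Loc) (M := Submonoid.powers D) _).2
      fun x y => ?_
    rw [(IsLocalization.injective Loc (powers_le_nonZeroDivisors_of_noZeroDivisors hD)).eq_iff]
    exact (IsFractionRing.injective A L).eq_iff.symm
  have ha : ∀ i : Fin r, IsUnit (algebraMap A Loc (MvPolynomial.X (0, i))) := fun i =>
    isUnit_of_dvd_unit (map_dvd _ (Finset.dvd_prod_of_mem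
      (fun i : Fin r => (MvPolynomial.X (0, i) : A)) (Finset.mem_univ i)))
      (IsLocalization.Away.algebraMap_isUnit (S := Loc) D)
  let ξ : Var r → Loc := xiUnits (fun i => (ha i).unit)
    (fun i => algebraMap A Loc (MvPolynomial.X (1, i)))
    (fun i => algebraMap A Loc (MvPolynomial.X (2, i)))
  have h1 : (ψ ∘ ξ : Var r → F) = t := by
    funext v
    refine (map_xiUnits (ψ : Loc →+* F) _ _ _ v).trans ?_
    rw [← xi_specialValue ht v]
    simp only [IsUnit.unit_spec, RingHom.coe_coe, hψ, he]
  have h2 : AlgebraicIndependent K ξ := AlgebraicIndependent.of_comp ψ (h1 ▸ htind)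
  convert h2.map' hιinj using 1
  funext v
  refine Eq.symm ((map_xiUnits (ι : Loc →+* L) _ _ _ v).trans ?_)
  simp only [IsUnit.unit_spec, RingHom.coe_coe, hι]
  rfl

end Independence
end Corner

namespace Corner

variable {K : Type*} [Field K] {r : ℕ}

/-! ### The Jacobian -/

section Jacobian

/-- Determinant of an upper bidiagonal matrix whose first column is replaced by `v`. -/
theorem det_bidiagonal_updateCol {R : Type*} [CommRing R] (n : ℕ) (v d W : ℕ → R) :
    (Matrix.of fun j k : Fin (n + 1) => if k = 0 then v j else
      if (j : ℕ) = k then d j else if (j : ℕ) + 1 = k then -W j else 0).det =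
      ∑ j ∈ Finset.range (n + 1), v j * (∏ k ∈ Finset.range j, W k) *
        ∏ k ∈ Finset.Ico (j + 1) (n + 1), d k := by
  induction n generalizing v d W with
  | zero => simp
  | succ n ih =>
    have h0 : (Matrix.of fun j k : Fin (n + 1) =>
        if (j : ℕ) = k then d (j + 1) else if (j : ℕ) + 1 = k then -W (j + 1) else 0).det =
        ∏ k ∈ Finset.Ico 1 (n + 2), d k := by
      rw [Matrix.det_of_isUpperTriangular]
      · simp only [Matrix.of_apply, if_true]
        rw [Fin.prod_univ_eq_prod_range (fun k => d (k + 1)), Finset.range_eq_Ico,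
          Finset.prod_Ico_add' d 0 (n + 1) 1]
      · intro i j hij
        have : (j : ℕ) < i := hij
        simp only [Matrix.of_apply]
        rw [if_neg (by omega), if_neg (by omega)]
    -- Only columns `0` and `1` meet row `0`: the first minor is triangular, and the second has the
    -- original shape in one size less, with cofactor `-(-W 0)`.
    rw [Matrix.det_succ_row_zero, Fin.sum_univ_succ, Fin.sum_univ_succ,
      Finset.sum_eq_zero (s := (Finset.univ : Finset (Fin n)))]
    · have e0 : ((Matrix.of fun j k : Fin (n + 1 + 1) => if k = 0 then v j else
          if (j : ℕ) = k then d j else if (j : ℕ) + 1 = k then -W j else 0).submatrix Fin.succ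
          (Fin.succAbove 0)) = Matrix.of fun j k : Fin (n + 1) =>
        if (j : ℕ) = k then d (j + 1) else if (j : ℕ) + 1 = k then -W (j + 1) else 0 := by
        ext j k
        simp [Fin.succ_ne_zero]
      have e1 : ((Matrix.of fun j k : Fin (n + 1 + 1) => if k = 0 then v j else
          if (j : ℕ) = k then d j else if (j : ℕ) + 1 = k then -W j else 0).submatrix Fin.succ
          (Fin.succAbove (Fin.succ 0))) = Matrix.of fun j k : Fin (n + 1) =>
        if k = 0 then v (j + 1) else
          if (j : ℕ) = k then d (j + 1) else if (j : ℕ) + 1 = k then -W (j + 1) else 0 := by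
        ext j k
        refine Fin.cases ?_ (fun k => ?_) k
        · simp
        · simp [Fin.succ_ne_zero]
      rw [e0, e1, h0, ih (fun j => v (j + 1)) (fun j => d (j + 1)) (fun j => W (j + 1)),
        Finset.sum_range_succ' _ (n + 1), add_zero, add_comm, Finset.mul_sum]
      congr 1
      · simp only [Matrix.of_apply]
        refine Finset.sum_congr rfl fun j _ => ?_
        rw [Finset.prod_range_succ' _ j, Finset.prod_Ico_add' d (j + 1) (n + 1) 1]
        simp
        ring
      · simp
    · intro i _
      have h1 : ¬ ((0 : ℕ) = i + 1 + 1) := by omega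
      have h2 : ¬ ((0 : ℕ) + 1 = i + 1 + 1) := by omega
      simp only [Matrix.of_apply, Fin.succ_ne_zero, if_false, Fin.val_zero, Fin.val_succ, h1, h2,
        mul_zero, zero_mul]

variable (K r)

/-- `s_j / (1 + s_j)`. -/
noncomputable def sLog (j : ℕ) : Series K r := sVar K r j * (1 + sVar K r j)⁻¹

/-- `w_j / (1 + w_j)`. -/
noncomputable def wLog (j : ℕ) : Series K r := wVar K r j * (1 + wVar K r j)⁻¹

/-- Logarithmic derivatives of `(1 + w_j) / (1 + s_j)`. -/
noncomputable def logRatio : Matrix (Fin r) (Var r) (Series K r) := Matrix.of fun j v =>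
  match v with
  | Sum.inl k => if j = k then -sLog K r j else 0
  | Sum.inr k => if (j : ℕ) = k then wLog K r j else 0

/-- Exponents of the `(1 + w_j) / (1 + s_j)` in `φ`. -/
noncomputable def ratioExp : Matrix (Var r) (Fin r) (Series K r) := Matrix.of fun v j =>
  match v with
  | Sum.inl _ => if (j : ℕ) = 0 then 1 else 0
  | Sum.inr i => (if (j : ℕ) = i then 1 else 0) + if (j : ℕ) = i + 1 then 1 else 0

variable {K r}

theorem one_add_sVar_ne (j : ℕ) : MvPowerSeries.constantCoeff (1 + sVar K r j) ≠ 0 := by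
  simp [constantCoeff_sVar]

theorem one_add_wVar_ne (j : ℕ) : MvPowerSeries.constantCoeff (1 + wVar K r j) ≠ 0 := by
  simp [constantCoeff_wVar]

/-- Logarithmic derivative, times the variable. -/
noncomputable def eulerLog {σ : Type*} (k : σ) (f : MvPowerSeries σ K) : MvPowerSeries σ K :=
  MvPowerSeries.X k * f⁻¹ * MvPowerSeries.pderiv K k f

theorem eulerLog_mul {σ : Type*} (k : σ) {f g : MvPowerSeries σ K}
    (hf : MvPowerSeries.constantCoeff f ≠ 0) (hg : MvPowerSeries.constantCoeff g ≠ 0) :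
    eulerLog k (f * g) = eulerLog k f + eulerLog k g := by
  have h1 := MvPowerSeries.mul_inv_cancel _ hf
  have h2 := MvPowerSeries.mul_inv_cancel _ hg
  simp only [eulerLog, MvPowerSeries.mul_inv_rev, Derivation.leibniz, smul_eq_mul]
  linear_combination MvPowerSeries.X k * f⁻¹ * MvPowerSeries.pderiv K k f * h2 +
    MvPowerSeries.X k * g⁻¹ * MvPowerSeries.pderiv K k g * h1

theorem eulerLog_inv {σ : Type*} (k : σ) {f : MvPowerSeries σ K}
    (hf : MvPowerSeries.constantCoeff f ≠ 0) : eulerLog k f⁻¹ = -eulerLog k f := by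
  have hf' : MvPowerSeries.constantCoeff f⁻¹ ≠ 0 := by
    rw [MvPowerSeries.constantCoeff_inv]
    exact inv_ne_zero hf
  have h := eulerLog_mul k hf hf'
  rw [MvPowerSeries.mul_inv_cancel _ hf, eulerLog, Derivation.map_one_eq_zero, mul_zero] at h
  linear_combination -h

theorem eulerLog_ratio (j : Fin r) (v : Var r) :
    eulerLog v ((1 + wVar K r j) * (1 + sVar K r j)⁻¹) = logRatio K r j v := by
  have hs' : MvPowerSeries.constantCoeff (1 + sVar K r j)⁻¹ ≠ 0 := by
    rw [MvPowerSeries.constantCoeff_inv]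
    exact inv_ne_zero (one_add_sVar_ne _)
  have hs : sVar K r j = MvPowerSeries.X (Sum.inl j) := fstExt_apply _ j
  rw [eulerLog_mul v (one_add_wVar_ne _) hs', eulerLog_inv v (one_add_sVar_ne _)]
  rcases v with k | k
  · have h1 : eulerLog (Sum.inl k) (1 + sVar K r j) = if j = k then sLog K r j else 0 := by
      rw [eulerLog, map_add, Derivation.map_one_eq_zero, zero_add, sLog, hs, MvPowerSeries.pderiv_X]
      split_ifs with h
      · rw [h, Pi.single_eq_same, mul_one]
      · rw [Pi.single_eq_of_ne (by simpa using h), mul_zero]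
    have h2 : eulerLog (Sum.inl k) (1 + wVar K r j) = 0 := by
      rw [eulerLog, map_add, Derivation.map_one_eq_zero, zero_add, wVar]
      by_cases h : (j : ℕ) < r - 1
      · rw [sndExt_apply _ ⟨j, h⟩, MvPowerSeries.pderiv_X_of_ne (by simp), mul_zero]
      · rw [sndExt_of_le _ (not_lt.1 h), map_zero, mul_zero]
    rw [h1, h2, zero_add]
    simp only [logRatio, Matrix.of_apply]
    split_ifs <;> simp
  · have h1 : eulerLog (Sum.inr k) (1 + sVar K r j) = 0 := by
      rw [eulerLog, map_add, Derivation.map_one_eq_zero, zero_add, hs,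
        MvPowerSeries.pderiv_X_of_ne (by simp), mul_zero]
    have h2 : eulerLog (Sum.inr k) (1 + wVar K r j) = if (j : ℕ) = k then wLog K r j else 0 := by
      rw [eulerLog, map_add, Derivation.map_one_eq_zero, zero_add, wLog]
      by_cases h : (j : ℕ) < r - 1
      · have hw : wVar K r j = MvPowerSeries.X (Sum.inr ⟨j, h⟩) := sndExt_apply _ ⟨j, h⟩
        rw [hw, MvPowerSeries.pderiv_X]
        split_ifs with hjk
        · have : (⟨j, h⟩ : Fin (r - 1)) = k := Fin.ext hjk
          rw [this, Pi.single_eq_same, mul_one]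
        · rw [Pi.single_eq_of_ne (by simpa [Fin.ext_iff] using hjk), mul_zero]
      · have hw : wVar K r j = 0 := sndExt_of_le _ (not_lt.1 h)
        rw [hw, map_zero, mul_zero, if_neg (by omega)]
    rw [h1, h2, neg_zero, add_zero]
    rfl

/-- Each `φ_v` is a monomial in the ratios `(1 + w_j)/(1 + s_j)`, and logarithmic derivatives are
additive. -/
theorem eulerLog_phi (v k : Var r) :
    eulerLog k (phi K r v) = ∑ j, ratioExp K r v j * logRatio K r j k := by
  rcases v with i | i
  · have h := eulerLog_ratio (K := K) (⟨0, i.pos⟩ : Fin r) k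
    rw [Finset.sum_eq_single (⟨0, i.pos⟩ : Fin r)]
    · rw [← h]
      simp [ratioExp, phi]
    · intro j _ hj
      have : (j : ℕ) ≠ 0 := fun h => hj (Fin.ext h)
      simp [ratioExp, this]
    · simp
  · have h1 := eulerLog_ratio (K := K) (⟨i, by omega⟩ : Fin r) k
    have h2 := eulerLog_ratio (K := K) (⟨i + 1, by omega⟩ : Fin r) k
    have hne : ∀ j, MvPowerSeries.constantCoeff ((1 + wVar K r j) * (1 + sVar K r j)⁻¹) ≠ 0 := by
      intro j
      rw [map_mul, MvPowerSeries.constantCoeff_inv]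
      exact mul_ne_zero (one_add_wVar_ne _) (inv_ne_zero (one_add_sVar_ne _))
    have hphi : phi K r (Sum.inr i) = ((1 + wVar K r i) * (1 + sVar K r i)⁻¹) *
        ((1 + wVar K r (i + 1)) * (1 + sVar K r (i + 1))⁻¹) := by
      rw [phi, MvPowerSeries.mul_inv_rev]
      ring
    rw [hphi, eulerLog_mul k (hne _) (hne _), h1, h2]
    have e1 : ∀ j : Fin r, ((j : ℕ) = i) ↔ j = ⟨i, by omega⟩ := fun j => by simp [Fin.ext_iff]
    have e2 : ∀ j : Fin r, ((j : ℕ) = i + 1) ↔ j = ⟨i + 1, by omega⟩ := fun j => by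
      simp [Fin.ext_iff]
    simp only [ratioExp, Matrix.of_apply, e1, e2, add_mul, ite_mul, one_mul, zero_mul,
      Finset.sum_add_distrib, Finset.sum_ite_eq', Finset.mem_univ, if_true]

theorem one_sub_wLog (j : ℕ) : 1 - wLog K r j = (1 + wVar K r j)⁻¹ := by
  have := MvPowerSeries.mul_inv_cancel _ (one_add_wVar_ne (K := K) (r := r) j)
  rw [wLog]
  linear_combination -this

theorem logRatio_mul_ratioExp (j k : Fin r) : (logRatio K r * ratioExp K r) j k =
    (if (k : ℕ) = 0 then -sLog K r j else 0) + (if (j : ℕ) = k then wLog K r j else 0) +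
      if (j : ℕ) + 1 = k then wLog K r j else 0 := by
  rw [Matrix.mul_apply, Fintype.sum_sum_type, add_assoc]
  congr 1
  · simp [logRatio, ratioExp]
  · by_cases h : (j : ℕ) < r - 1
    · have e1 : ∀ i : Fin (r - 1), ((j : ℕ) = i) ↔ i = ⟨j, h⟩ := fun i => by
        simp [Fin.ext_iff, eq_comm]
      simp only [logRatio, ratioExp, Matrix.of_apply, e1, ite_mul, zero_mul, Finset.sum_ite_eq',
        Finset.mem_univ, if_true]
      simp only [mul_add, mul_ite, mul_one, mul_zero, eq_comm]
    · have hw : wLog K r j = 0 := by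
        have hw : wVar K r j = 0 := sndExt_of_le _ (not_lt.1 h)
        rw [wLog, hw, zero_mul]
      simp [logRatio, hw]

/-! ### The terms of `S` and the evaluation of the Jacobian. -/

theorem STerm_neg_one : STerm K r (-1) = ∏ k ∈ Finset.range r, (1 + wVar K r k)⁻¹ := by
  refine Finset.prod_congr rfl fun j _ => ?_
  have h1 : step (-1) j = 0 := if_neg (by omega)
  have h2 : delta (-1) j = 0 := if_neg (by omega)
  simp [h1, h2]

theorem STerm_natCast {i : ℕ} (hi : i < r) : STerm K r i =
    sLog K r i * (∏ k ∈ Finset.range i, wLog K r k) *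
      ∏ k ∈ Finset.Ico (i + 1) r, (1 + wVar K r k)⁻¹ := by
  rw [STerm, ← Finset.prod_range_mul_prod_Ico _ hi, Finset.prod_range_succ, mul_comm (sLog K r i)]
  congr 1
  · congr 1
    · refine Finset.prod_congr rfl fun j hj => ?_
      have := Finset.mem_range.1 hj
      have h1 : step i j = 1 := if_pos (by omega)
      have h2 : delta i j = 0 := if_neg (by omega)
      simp [h1, h2, wLog]
    · have h1 : step i i = 0 := if_neg (by omega)
      have h2 : delta i i = 1 := if_pos rfl
      simp [h1, h2, sLog]
  · refine Finset.prod_congr rfl fun j hj => ?_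
    have := (Finset.mem_Ico.1 hj).1
    have h1 : step i j = 0 := if_neg (by omega)
    have h2 : delta i j = 0 := if_neg (by omega)
    simp [h1, h2]

theorem S_eq_sum_STerm : S K r = ∑ i ∈ Finset.Icc (-1 : ℤ) (r - 1), STerm K r i := by
  -- The extra factor at `k = r - 1` is `1`, because `w_{r-1} = 0`.
  have hd : ∏ k ∈ Finset.range (r - 1), (1 + wVar K r k)⁻¹ =
      ∏ k ∈ Finset.range r, (1 + wVar K r k)⁻¹ := by
    cases r with
    | zero => rfl
    | succ n =>
      have hw : wVar K (n + 1) n = 0 := sndExt_of_le _ le_rfl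
      rw [Finset.prod_range_succ, hw, add_zero, inv_one, mul_one, Nat.add_sub_cancel]
  rw [sum_Icc_neg_one, S, hd, add_mul, one_mul, STerm_neg_one, Finset.sum_mul]
  congr 1
  refine Finset.sum_congr rfl fun j hj => ?_
  have hj := Finset.mem_range.1 hj
  rw [STerm_natCast hj, ← Finset.prod_range_mul_prod_Ico _ hj, Finset.prod_range_succ]
  simp only [wLog, Finset.prod_mul_distrib, sLog]
  have := MvPowerSeries.mul_inv_cancel _ (one_add_wVar_ne (K := K) (r := r) j)
  linear_combination sVar K r j * (1 + sVar K r j)⁻¹ * (∏ k ∈ Finset.range j, wVar K r k) *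
    (∏ k ∈ Finset.range j, (1 + wVar K r k)⁻¹) *
    (∏ k ∈ Finset.Ico (j + 1) r, (1 + wVar K r k)⁻¹) * this

/-- The identity `det(1 - EL) = det(1 - LE)` reduces the size from `2r - 1` to `r`, one row for each
ratio. -/
theorem lagrangeJacobian_phi (hr : 0 < r) : lagrangeJacobian (phi K r) = S K r := by
  have h1 : lagrangeJacobian (phi K r) = (1 - ratioExp K r * logRatio K r).det := by
    rw [lagrangeJacobian]
    congr 1
    ext1 v k
    rw [Matrix.sub_apply, Matrix.mul_apply, Matrix.one_apply, ← eulerLog_phi]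
    rfl
  rw [h1, Matrix.det_one_sub_mul_comm, S_eq_sum_STerm, sum_Icc_neg_one, STerm_neg_one]
  obtain ⟨n, rfl⟩ : ∃ n, r = n + 1 := ⟨r - 1, by omega⟩
  -- The extra summand in the corner entry yields the term `i = -1` of `S`; the summand `s_i/(1 +
  -- s_i)` in row `i` of the first column yields the term `i`.
  have h2 : 1 - logRatio K (n + 1) * ratioExp K (n + 1) =
      Matrix.of fun j k : Fin (n + 1) => if k = 0 then
        (fun j : ℕ => sLog K (n + 1) j + if j = 0 then (1 + wVar K (n + 1) 0)⁻¹ else 0) j else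
      if (j : ℕ) = k then (fun j => (1 + wVar K (n + 1) j)⁻¹) j else
        if (j : ℕ) + 1 = k then -wLog K (n + 1) j else 0 := by
    ext1 j k
    rw [Matrix.sub_apply, Matrix.one_apply, logRatio_mul_ratioExp, Matrix.of_apply]
    simp only [← one_sub_wLog, Fin.ext_iff, Fin.val_zero]
    by_cases hk : (k : ℕ) = 0
    · by_cases hj : (j : ℕ) = 0
      · simp [hk, hj]
        ring
      · simp [hk, hj]
    · by_cases hj : (j : ℕ) = k
      · simp [hk, hj]
      · simp [hk, hj]
        split_ifs <;> simp
  rw [h2, det_bidiagonal_updateCol n (fun j : ℕ => sLog K (n + 1) j +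
    if j = 0 then (1 + wVar K (n + 1) 0)⁻¹ else 0) (fun j => (1 + wVar K (n + 1) j)⁻¹)
    (wLog K (n + 1))]
  simp only [add_mul, Finset.sum_add_distrib]
  refine (add_comm _ _).trans (congrArg₂ (· + ·) ?_ ?_)
  · simp only [ite_mul, zero_mul, Finset.sum_ite_eq', Finset.mem_range, Nat.zero_lt_succ, if_true,
      Finset.prod_range_zero, mul_one, zero_add]
    rw [← Finset.prod_range_mul_prod_Ico _ (Nat.succ_le_succ (Nat.zero_le n)),
      Finset.prod_range_one]
  · exact Finset.sum_congr rfl fun i hi => (STerm_natCast (Finset.mem_range.1 hi)).symm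

end Jacobian

end Corner

/-! ### Assembly of the theorem. -/

theorem mainTheorem5 {K : Type*} [Field K] [CharZero K] (r : ℕ) (hr : 1 ≤ r) :
    -- the Jacobian: `J = S`, a sum of `r + 1` terms
    (Corner.lagrangeJacobian (Corner.phi K r) = Corner.S K r ∧
      Corner.S K r = ∑ i ∈ Finset.Icc (-1 : ℤ) (r - 1), Corner.STerm K r i) ∧
    -- the number of variables, and their independence
    Fintype.card (Corner.Var r) = 2 * (r + 1) - 3 ∧
    AlgebraicIndependent K
      (Corner.xi
        (K := FractionRing (MvPolynomial (Fin 3 × Fin r) K))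
        (R := FractionRing (MvPolynomial (Fin 3 × Fin r) K))
        (fun i => algebraMap (MvPolynomial (Fin 3 × Fin r) K) _ (MvPolynomial.X (0, i)))
        (fun i => algebraMap (MvPolynomial (Fin 3 × Fin r) K) _ (MvPolynomial.X (1, i)))
        (fun i => algebraMap (MvPolynomial (Fin 3 × Fin r) K) _ (MvPolynomial.X (2, i)))) ∧
    -- `Φ` is a Horn series, with the Pochhammer form for `μ_j ≥ 1`
    (∀ μ : Fin r → ℤ, Corner.IsHornSeries (Corner.Phi K r μ) ∧
      ((∀ j, 1 ≤ μ j) → Corner.Phi K r μ = Corner.PhiPoch K r μ)) ∧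
    -- the formal solution `u` of the quadratic system and the expansion of its monomials
    ∃ u : Fin r → (Corner.Series K r)ˣ,
      (∀ u' : Fin r → Corner.Series K r,
        Corner.IsCornerSolution MvPowerSeries.X u' ↔ u' = fun i => (u i : Corner.Series K r)) ∧
      (∀ i, MvPowerSeries.constantCoeff (u i : Corner.Series K r) = 1) ∧
      -- the Lagrange-type system `ξ_v = η_v / φ_v(η)`
      (∀ v : Corner.Var r,
        MvPowerSeries.X v *
            MvPowerSeries.subst (Corner.etaOf MvPowerSeries.X u) (Corner.phi K r v) =
          Corner.etaOf MvPowerSeries.X u v) ∧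
      (∀ k : Fin r → ℤ,
        ((∏ i, u i ^ k i : (Corner.Series K r)ˣ) : Corner.Series K r) =
          ∑ i ∈ Finset.Icc (-1 : ℤ) (r - 1),
            Corner.monoF MvPowerSeries.X i *
              Corner.Phi K r (Corner.piVec k + Corner.nuVec i)) ∧
      -- the eigenvalue problem
      (∀ α : Fin (r + 1) → K, (∀ i, i ≠ 0 → α i ≠ α 0) →
        ∃ (lam : Corner.OffDiagSeries K r) (V : Fin (r + 1) → Corner.OffDiagSeries K r)
          (U : Fin r → (Corner.OffDiagSeries K r)ˣ),
          (∀ lam' V', Corner.IsCornerBranch α lam' V' ↔ lam' = lam ∧ V' = V) ∧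
          lam = MvPowerSeries.C (α 0) + Corner.bVar K r ⟨0, hr⟩ * V ⟨1, by omega⟩ ∧
          (∀ j : Fin r, V j.succ =
            Corner.vZero (fun i => α i.succ - α 0) (Corner.cVar K r) j * U j) ∧
          (∀ j : Fin r, (U j : Corner.OffDiagSeries K r) =
            MvPowerSeries.subst
              (Corner.xi (fun i => α i.succ - α 0) (Corner.bVar K r) (Corner.cVar K r))
              (u j : Corner.Series K r)) ∧
          ∀ k : Fin r → ℤ,
            ((∏ i, U i ^ k i : (Corner.OffDiagSeries K r)ˣ) : Corner.OffDiagSeries K r) =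
              ∑ i ∈ Finset.Icc (-1 : ℤ) (r - 1),
                Corner.monoF
                    (Corner.xi (fun i => α i.succ - α 0) (Corner.bVar K r) (Corner.cVar K r)) i *
                  MvPowerSeries.subst
                    (Corner.xi (fun i => α i.succ - α 0) (Corner.bVar K r) (Corner.cVar K r))
                    (Corner.Phi K r (Corner.piVec k + Corner.nuVec i))) := by
  have hsol := Corner.isCornerSolution_cornerU (K := K) (r := r)
  have hX : ∀ v : Corner.Var r, MvPowerSeries.constantCoeff (MvPowerSeries.X v : Corner.Series K r) = 0 :=
    fun v => MvPowerSeries.constantCoeff_X v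
  refine ⟨⟨Corner.lagrangeJacobian_phi hr, Corner.S_eq_sum_STerm⟩, ?_, Corner.algebraicIndependent_xi,
    fun μ => ⟨Corner.isHornSeries_Phi μ, Corner.Phi_eq_PhiPoch⟩, Corner.cornerU K r, fun u' => ⟨fun h => h.eq hX hsol, ?_⟩,
    fun i => ?_, Corner.X_mul_subst_phi hsol, Corner.coe_prod_cornerU_zpow, fun α hα => ?_⟩
  · simp only [Fintype.card_sum, Fintype.card_fin]
    omega
  · rintro rfl
    exact hsol
  · rw [← Corner.uExt_succ (fun i => (Corner.cornerU K r i : Corner.Series K r)) i]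
    exact hsol.constantCoeff_uExt hX _
  · set ξ := Corner.xi (fun i => α i.succ - α 0) (Corner.bVar K r) (Corner.cVar K r)
    have hξ : MvPowerSeries.HasSubst ξ :=
      MvPowerSeries.hasSubst_of_constantCoeff_zero (Corner.constantCoeff_xi _)
    -- The substituted series have no constant term, so substitution is a ring homomorphism: it
    -- carries the quadratic system, the units `u_i` and the expansions of `u^k` over to series in
    -- `b, c`.
    set Ψ : Corner.Series K r →+* Corner.OffDiagSeries K r := (MvPowerSeries.substAlgHom (R := K) hξ).toRingHom
    have hΨ : ∀ f, Ψ f = MvPowerSeries.subst ξ f := MvPowerSeries.substAlgHom_apply hξ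
    have hΨX : (fun v => Ψ (MvPowerSeries.X v)) = ξ :=
      funext fun v => MvPowerSeries.substAlgHom_X hξ v
    have hU : Corner.IsCornerSolution ξ fun i => Ψ (Corner.cornerU K r i : Corner.Series K r) := by
      have := hsol.map Ψ
      rwa [hΨX] at this
    have hb := Corner.isCornerBranch_of_isCornerSolution hr hα hU
      (V := Fin.cons 1 fun j => Corner.vZero (fun i => α i.succ - α 0) (Corner.cVar K r) j *
        Ψ (Corner.cornerU K r j : Corner.Series K r)) rfl fun j => rfl
    refine ⟨_, _, fun i => Units.map (Ψ : Corner.Series K r →* Corner.OffDiagSeries K r) (Corner.cornerU K r i),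
      fun lam' V' => ⟨fun h => h.eq hr hα hb, ?_⟩, rfl, fun j => rfl, fun j => hΨ _, fun k => ?_⟩
    · rintro ⟨rfl, rfl⟩
      exact hb
    · simp only [← map_zpow, ← map_prod, Units.coe_map, MonoidHom.coe_coe, Corner.coe_prod_cornerU_zpow]
      rw [Corner.cornerSum, map_sum]
      refine Finset.sum_congr rfl fun i _ => ?_
      rw [map_mul, Corner.monoF_map, hΨX, hΨ]
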